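/- Let $n\ge 1$ and let $\mathbf R^{1,n}=\mathbf R\times\mathbf R^n$ be Minkowski space, with the flat metric $\mathsf b=-dt^2+dp_1^2+\dots+dp_n^2$, time-oriented by $\partial_t$; lightlike vectors are nonzero. A future causal (resp. timelike) curve is a piecewise smooth curve whose velocities are future causal (resp. timelike). Write $x\le y$ if $x=y$ or there is a future causal curve from $x$ to $y$, write $I^+(A)$ for the set of endpoints of future timelike curves starting in $A$, and put $\mathcal T(x,y)=\sqrt{|\mathsf b(y-x,y-x)|}$ for $x\le y$. Let $\Omega\subset\mathbf R^{1,n}$ be a domain, i.e. a non-empty, connected, open, proper subset. Assume that $\Omega$ is convex, that it is future complete (every future causal curve of $\mathbf R^{1,n}$ starting in $\Omega$ stays in $\Omega$), and that it contains no complete affine lightlike line. Let $\tau(x)=\sup\{\mathcal T(y,x) : y\in\Omega,\ y\le x\}$ be the cosmological time of $\Omega$. Let $\hat d_{\ln\tau}$ be the null distance of $\ln\tau$: $$\hat d_{\ln\tau}(x,y)=\inf\sum_{k=1}^{m-1}|\ln\tau(x_{k+1})-\ln\tau(x_k)|,$$ the infimum being over all finite sequences $x=x_1,\dots,x_m=y$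 in $\Omega$ such that any two consecutive points are joined in $\Omega$ by a causal curve or coincide. Let $\delta_\Omega$ be the Markowitz pseudodistance: $$\delta_\Omega(x,y)=\inf\sum_{k=1}^m\rho_I(s_k,t_k),\qquad \rho_I(s,t)=\left|\ln\frac{(s-1)(t+1)}{(s+1)(t-1)}\right|,\quad I=(-1,1),$$ the infimum being over all $m\ge1$, all projectively parametrized lightlike geodesics $\gamma_1,\dots,\gamma_m:I\to\Omega$ and all $s_k,t_k\in I$ with $\gamma_1(s_1)=x$, $\gamma_m(t_m)=y$ and $\gamma_k(t_k)=\gamma_{k+1}(s_{k+1})$. Here a projectively parametrized lightlike geodesic is a map $\ell\circ u^{-1}$ with $\ell(t)=p+tv$ an affine lightlike geodesic in $\Omega$ defined on an open interval $J$, and $u:J\to I$ a smooth bijection with $u'\neq 0$ and vanishing Schwarzian derivative. Then $0<\tau<\infty$ on $\Omega$, the function $\ln\tau$ is a time function on $\Omega$ (continuous and strictly increasing along future causal curves), $\delta_\Omega$ is finite, and for all $x,y\in\Omega$ $$\hat d_{\ln\tau}(x,y)\le\delta_\Omega(x,y)\le 2\,\hat d_{\ln\tau}(x,y).$$ Moreover,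 $\hat d_{\ln\tau}=\delta_\Omega$ on $\Omega\times\Omega$ if and only if $\Omega=I^+(H)$ for some spacelike affine hyperplane $H$, and $\delta_\Omega=2\,\hat d_{\ln\tau}$ on $\Omega\times\Omega$ if and only if $\Omega=I^+(\{a\})$ for some point $a\in\mathbf R^{1,n}$. -/

import Mathlib

open scoped ContDiff ENNReal

/-- The vector space underlying Minkowski space `ℝ^{1,n}`, with coordinates `(t, p)`. -/
abbrev Mink (n : ℕ) : Type := ℝ × EuclideanSpace ℝ (Fin n)

namespace Mink

noncomputable section

variable {n : ℕ}

/-- The flat Lorentzian form `-dt² + dp₁² + ⋯ + dpₙ²`. -/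
def form (v w : Mink n) : ℝ := -(v.1 * w.1) + inner ℝ v.2 w.2

/-- The unit timelike vector `∂ₜ` defining the time orientation. -/
def dt : Mink n := (1, 0)

/-- Nonzero null vectors. -/
def IsLightlike (v : Mink n) : Prop := v ≠ 0 ∧ form v v = 0

def IsFutureCausal (v : Mink n) : Prop := form v v ≤ 0 ∧ form v dt < 0

def IsFutureTimelike (v : Mink n) : Prop := form v v < 0 ∧ form v dt < 0

/-- `γ` restricted to `[a, b]`, `a < b`, is a piecewise smooth curve: it is smooth on each closed
interval of a finite subdivision, and all its (one-sided, at the nodes) velocities satisfy `P`. -/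
def IsPiecewiseSmoothCurve (P : Mink n → Prop) (γ : ℝ → Mink n) (a b : ℝ) : Prop :=
  a < b ∧ ∃ (N : ℕ) (s : Fin (N + 1) → ℝ), StrictMono s ∧ s 0 = a ∧ s (Fin.last N) = b ∧
    ∀ i : Fin N, ContDiffOn ℝ ∞ γ (Set.Icc (s i.castSucc) (s i.succ)) ∧
      ∀ t ∈ Set.Icc (s i.castSucc) (s i.succ),
        P (derivWithin γ (Set.Icc (s i.castSucc) (s i.succ)) t)

/-- There is a curve in `Ω` from `x` to `y` whose velocities satisfy `P`. -/
def JoinedBy (P : Mink n → Prop) (Ω : Set (Mink n)) (x y : Mink n) : Prop :=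
  ∃ (γ : ℝ → Mink n) (a b : ℝ), IsPiecewiseSmoothCurve P γ a b ∧
    (∀ t ∈ Set.Icc a b, γ t ∈ Ω) ∧ γ a = x ∧ γ b = y

/-- The relation `x ≤ y` of the spacetime `Ω`. -/
def CausalLE (Ω : Set (Mink n)) (x y : Mink n) : Prop :=
  x = y ∨ JoinedBy IsFutureCausal Ω x y

/-- The relation `x ≪ y` of Minkowski space. -/
def ChronLT (x y : Mink n) : Prop := JoinedBy IsFutureTimelike Set.univ x y

/-- The causal past `J⁻(x)` in Minkowski space. -/
def causalPast (x : Mink n) : Set (Mink n) := {y | CausalLE Set.univ y x}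

/-- The chronological future `I⁺(A)` in Minkowski space. -/
def chronFuture (A : Set (Mink n)) : Set (Mink n) := {y | ∃ x ∈ A, ChronLT x y}

/-- The time separation of two causally related points. -/
def timeSep (x y : Mink n) : ℝ := √|form (y - x) (y - x)|

/-- Domains: nonempty connected proper open subsets. -/
def IsSpacetimeDomain (Ω : Set (Mink n)) : Prop :=
  IsOpen Ω ∧ IsConnected Ω ∧ Ω ≠ Set.univ

/-- Every future causal curve starting in `Ω` stays in `Ω`. -/
def IsFutureComplete (Ω : Set (Mink n)) : Prop :=
  ∀ (γ : ℝ → Mink n) (a b : ℝ), IsPiecewiseSmoothCurve IsFutureCausal γ a b → γ a ∈ Ω →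
    ∀ t ∈ Set.Icc a b, γ t ∈ Ω

def ContainsLightlikeLine (Ω : Set (Mink n)) : Prop :=
  ∃ x v : Mink n, IsLightlike v ∧ ∀ s : ℝ, x + s • v ∈ Ω

/-- Spacelike affine hyperplanes. -/
def IsSpacelikeHyperplane (H : AffineSubspace ℝ (Mink n)) : Prop :=
  (H : Set (Mink n)).Nonempty ∧ Module.finrank ℝ H.direction = n ∧
    ∀ v ∈ H.direction, v ≠ 0 → 0 < form v v

/-- The (past) cosmological time of `Ω`, with values in `[0, ∞]`. -/
def cosmologicalTime (Ω : Set (Mink n)) (x : Mink n) : ℝ≥0∞ :=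
  ⨆ y ∈ Ω ∩ causalPast x, ENNReal.ofReal (timeSep y x)

/-- The function `ln τ`; meaningful where `0 < τ < ∞`. -/
def logTime (Ω : Set (Mink n)) (x : Mink n) : ℝ := Real.log (cosmologicalTime Ω x).toReal

/-- Time functions on `Ω`: continuous and strictly increasing along future causal curves. -/
def IsTimeFunction (Ω : Set (Mink n)) (f : Mink n → ℝ) : Prop :=
  ContinuousOn f Ω ∧ ∀ x y, JoinedBy IsFutureCausal Ω x y → f x < f y

/-- Finite sequences of points of `Ω` from `x` to `y` whose consecutive members are causally
related in `Ω`. -/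
structure CausalChain (Ω : Set (Mink n)) (x y : Mink n) where
  m : ℕ
  pt : Fin (m + 1) → Mink n
  mem : ∀ k, pt k ∈ Ω
  head : pt 0 = x
  last : pt (Fin.last m) = y
  related : ∀ k : Fin m,
    CausalLE Ω (pt k.castSucc) (pt k.succ) ∨ CausalLE Ω (pt k.succ) (pt k.castSucc)

/-- The null distance of the time function `f` on `Ω` (an infimum in `[0, ∞]`). -/
def nullDist (Ω : Set (Mink n)) (f : Mink n → ℝ) (x y : Mink n) : ℝ≥0∞ :=
  ⨅ c : CausalChain Ω x y,
    ENNReal.ofReal (∑ k : Fin c.m, |f (c.pt k.succ) - f (c.pt k.castSucc)|)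

/-- The Schwarzian derivative. -/
def schwarzian (u : ℝ → ℝ) (t : ℝ) : ℝ :=
  iteratedDeriv 3 u t / deriv u t - 3 / 2 * (iteratedDeriv 2 u t / deriv u t) ^ 2

/-- The interval `I = (-1, 1)`. -/
def baseInterval : Set ℝ := Set.Ioo (-1) 1

/-- `γ : I → Ω` is a projectively parametrized lightlike geodesic of `Ω`: it is `ℓ ∘ u⁻¹`, where
`ℓ(t) = p + t v` is a lightlike geodesic of the flat metric in `Ω`, defined on an open interval
`J`, and `u : J → I` is a projective parameter along `ℓ`. As the flat metric has vanishing Ricci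
tensor, the latter means that the Schwarzian derivative of `u` is zero. -/
def IsPPL (Ω : Set (Mink n)) (γ : ℝ → Mink n) : Prop :=
  ∃ (J : Set ℝ) (p v : Mink n) (u : ℝ → ℝ), IsOpen J ∧ J.OrdConnected ∧ IsLightlike v ∧
    (∀ t ∈ J, p + t • v ∈ Ω) ∧
    ContDiffOn ℝ ∞ u J ∧ (∀ t ∈ J, deriv u t ≠ 0) ∧ (∀ t ∈ J, schwarzian u t = 0) ∧
    Set.BijOn u J baseInterval ∧ ∀ t ∈ J, γ (u t) = p + t • v

/-- The distance `ρ_I` of the interval `I`. -/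
def rhoI (s t : ℝ) : ℝ := |Real.log (((s - 1) * (t + 1)) / ((s + 1) * (t - 1)))|

/-- Lightlike chains in `Ω` from `x` to `y`, with `m + 1` members. -/
structure LightlikeChain (Ω : Set (Mink n)) (x y : Mink n) where
  m : ℕ
  γ : Fin (m + 1) → ℝ → Mink n
  s : Fin (m + 1) → ℝ
  t : Fin (m + 1) → ℝ
  ppl : ∀ k, IsPPL Ω (γ k)
  s_mem : ∀ k, s k ∈ baseInterval
  t_mem : ∀ k, t k ∈ baseInterval
  head : γ 0 (s 0) = x
  last : γ (Fin.last m) (t (Fin.last m)) = y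
  link : ∀ k : Fin m, γ k.castSucc (t k.castSucc) = γ k.succ (s k.succ)

/-- The Markowitz pseudodistance of `Ω` (an infimum in `[0, ∞]`). -/
def markowitzDist (Ω : Set (Mink n)) (x y : Mink n) : ℝ≥0∞ :=
  ⨅ c : LightlikeChain Ω x y, ENNReal.ofReal (∑ k, rhoI (c.s k) (c.t k))

end

end Mink

/-! Everything is decided on lightlike rays. Since `Ω` is future complete and contains no lightlike
line, every future lightlike geodesic of `Ω` extends to a ray `z + s v`, `s > 0`, issuing from a
boundary point `z` (`exists_ray`). On such a ray the Markowitz distance between parameters `s ≤ t`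
is exactly `ln (t / s)`. The projective parameter `(s - 1) / (s + 1)` of a half-line gives the upper
bound. For the lower bound, the logarithm of a positive affine function varies by at most `rhoI` in
a projective parameter (`abs_log_affine_le_rhoI`), and a functional supporting `Ω` at `z` is such a
function (`le_markowitzDist_ray`).

The cosmological time is the Lorentzian length of a segment from a boundary point
(`exists_retract`). On a ray, `τ / s` is nonincreasing because `Ω` is convex (`tau_ray_le`), and `τ²
/ s` is nondecreasing because boundary points are never timelike related (`tau_sq_ray_le`). Hence
`√(t / s) ≤ τ(t) / τ(s) ≤ t / s`. The right inequality gives `d̂ ≤ δ`, as a lightlike chain is a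
causal chain; the left one gives `δ ≤ 2 d̂`, as a causal vector is a sum of two lightlike ones.

If one of the global inequalities is an equality, `τ`, respectively `τ²`, is linear on every ray. In
the first case an affine majorant touching the concave function `τ` at one point coincides with it
along rays, hence everywhere, and `Ω` is a half-space (`eq_halfSpace`). In the second case the
squared length from the retract of one point plays this role as a minorant of `τ²`, and `Ω` is a
cone (`eq_cone`). Conversely, `τ` is explicit on half-spaces and cones. -/

namespace Mink

variable {n : ℕ}

/-! ### The Lorentzian form and the causal cone -/

theorem form_comm (v w : Mink n) : form v w = form w v := by
  simp only [form, real_inner_comm, mul_comm]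

theorem form_add_left (v w x : Mink n) : form (v + w) x = form v x + form w x := by
  simp only [form, Prod.fst_add, Prod.snd_add, inner_add_left]; ring

theorem form_add_right (v w x : Mink n) : form x (v + w) = form x v + form x w := by
  simp only [form, Prod.fst_add, Prod.snd_add, inner_add_right]; ring

theorem form_sub_left (v w x : Mink n) : form (v - w) x = form v x - form w x := by
  simp only [form, Prod.fst_sub, Prod.snd_sub, inner_sub_left]; ring

theorem form_sub_right (v w x : Mink n) : form x (v - w) = form x v - form x w := by
  simp only [form, Prod.fst_sub, Prod.snd_sub, inner_sub_right]; ring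

theorem form_smul_left (c : ℝ) (v x : Mink n) : form (c • v) x = c * form v x := by
  simp only [form, Prod.smul_fst, Prod.smul_snd, inner_smul_left, smul_eq_mul]
  simp; ring

theorem form_smul_right (c : ℝ) (v x : Mink n) : form x (c • v) = c * form x v := by
  rw [form_comm, form_smul_left, form_comm]

theorem form_self (v : Mink n) : form v v = ‖v.2‖ ^ 2 - v.1 ^ 2 := by
  simp only [form, real_inner_self_eq_norm_sq]; ring

theorem form_dt (v : Mink n) : form v dt = -v.1 := by
  simp [form, dt]

/-- The closed cone of future causal vectors, with the zero vector. -/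
def InCone (v : Mink n) : Prop := ‖v.2‖ ≤ v.1

theorem InCone.fst_nonneg {v : Mink n} (h : InCone v) : 0 ≤ v.1 := (norm_nonneg _).trans h

theorem inCone_zero : InCone (0 : Mink n) := by simp [InCone]

theorem InCone.add {v w : Mink n} (hv : InCone v) (hw : InCone w) : InCone (v + w) :=
  (norm_add_le _ _).trans (add_le_add hv hw)

theorem InCone.smul {v : Mink n} (hv : InCone v) {c : ℝ} (hc : 0 ≤ c) : InCone (c • v) := by
  simp only [InCone, Prod.smul_fst, Prod.smul_snd, norm_smul, Real.norm_eq_abs, abs_of_nonneg hc,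
    smul_eq_mul]
  exact mul_le_mul_of_nonneg_left hv hc

theorem isClosed_inCone : IsClosed {v : Mink n | InCone v} :=
  isClosed_le (by fun_prop) (by fun_prop)

theorem isFutureCausal_iff {v : Mink n} : IsFutureCausal v ↔ InCone v ∧ 0 < v.1 := by
  simp only [IsFutureCausal, form_self, form_dt, InCone, neg_lt_zero]
  refine and_congr_left fun h => ?_
  rw [sub_nonpos, sq_le_sq₀ (norm_nonneg _) h.le]

theorem isFutureTimelike_iff {v : Mink n} : IsFutureTimelike v ↔ ‖v.2‖ < v.1 := by
  simp only [IsFutureTimelike, form_self, form_dt, neg_lt_zero]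
  constructor
  · rintro ⟨h, h'⟩
    rwa [sub_neg, sq_lt_sq₀ (norm_nonneg _) h'.le] at h
  · intro h
    have h' := (norm_nonneg _).trans_lt h
    exact ⟨by rwa [sub_neg, sq_lt_sq₀ (norm_nonneg _) h'.le], h'⟩

theorem IsFutureTimelike.inCone {v : Mink n} (h : IsFutureTimelike v) : InCone v :=
  (isFutureTimelike_iff.1 h).le

theorem IsFutureTimelike.fst_pos {v : Mink n} (h : IsFutureTimelike v) : 0 < v.1 :=
  (norm_nonneg _).trans_lt (isFutureTimelike_iff.1 h)

theorem InCone.isFutureCausal {v : Mink n} (h : InCone v) (h0 : v ≠ 0) : IsFutureCausal v := by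
  refine isFutureCausal_iff.2 ⟨h, h.fst_nonneg.lt_of_ne fun h1 => h0 ?_⟩
  have h2 : ‖v.2‖ ≤ 0 := h1 ▸ h
  exact Prod.ext h1.symm (norm_le_zero_iff.1 h2)

theorem isFutureTimelike_dt : IsFutureTimelike (dt : Mink n) :=
  isFutureTimelike_iff.2 (by simp [dt])

theorem IsFutureTimelike.smul {v : Mink n} (hv : IsFutureTimelike v) {c : ℝ} (hc : 0 < c) :
    IsFutureTimelike (c • v) := by
  rw [isFutureTimelike_iff] at *
  simp only [Prod.smul_fst, Prod.smul_snd, norm_smul, Real.norm_eq_abs, abs_of_pos hc,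
    smul_eq_mul]
  exact mul_lt_mul_of_pos_left hv hc

theorem isOpen_isFutureTimelike : IsOpen {v : Mink n | IsFutureTimelike v} := by
  simp only [isFutureTimelike_iff]
  exact isOpen_lt (by fun_prop) (by fun_prop)

/-- Future lightlike vectors. -/
def IsFutureLightlike (v : Mink n) : Prop := ‖v.2‖ = v.1 ∧ 0 < v.1

theorem IsFutureLightlike.inCone {v : Mink n} (h : IsFutureLightlike v) : InCone v := h.1.le

theorem IsFutureLightlike.form_self {v : Mink n} (h : IsFutureLightlike v) : form v v = 0 := by
  rw [Mink.form_self, h.1, sub_self]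

theorem IsFutureLightlike.isLightlike {v : Mink n} (h : IsFutureLightlike v) : IsLightlike v :=
  ⟨fun h0 => by simpa [h0] using h.2, h.form_self⟩

theorem IsLightlike.future_or_past {v : Mink n} (h : IsLightlike v) :
    IsFutureLightlike v ∨ IsFutureLightlike (-v) := by
  obtain ⟨h0, h1⟩ := h
  have h2 : ‖v.2‖ = |v.1| := by
    rw [Mink.form_self, sub_eq_zero] at h1
    rw [← abs_norm, ← sq_eq_sq_iff_abs_eq_abs, h1]
  rcases lt_trichotomy v.1 0 with h3 | h3 | h3
  · right; exact ⟨by simpa [abs_of_neg h3] using h2, by simpa using h3⟩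
  · exact absurd (Prod.ext h3 (norm_eq_zero.1 (by simpa [h3] using h2))) h0
  · left; exact ⟨by rw [h2, abs_of_pos h3], h3⟩

theorem neg_form_ge {v w : Mink n} : v.1 * w.1 - ‖v.2‖ * ‖w.2‖ ≤ -form v w := by
  have := real_inner_le_norm v.2 w.2
  simp only [form]; linarith

theorem InCone.neg_form_nonneg {v w : Mink n} (hv : InCone v) (hw : InCone w) :
    0 ≤ -form v w := by
  have := mul_le_mul hv hw (norm_nonneg _) hv.fst_nonneg
  linarith [neg_form_ge (v := v) (w := w)]

theorem IsFutureTimelike.neg_form_pos {v w : Mink n} (hv : IsFutureTimelike v) (hw : InCone w)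
    (hw0 : 0 < w.1) : 0 < -form v w := by
  have h1 := isFutureTimelike_iff.1 hv
  have : ‖v.2‖ * ‖w.2‖ ≤ ‖v.2‖ * w.1 := mul_le_mul_of_nonneg_left hw (norm_nonneg _)
  have := mul_lt_mul_of_pos_right h1 hw0
  linarith [neg_form_ge (v := v) (w := w)]

/-- The Lorentzian length of a vector. -/
noncomputable def len (v : Mink n) : ℝ := √|form v v|

theorem len_nonneg (v : Mink n) : 0 ≤ len v := Real.sqrt_nonneg _

theorem continuous_len : Continuous (len : Mink n → ℝ) := by
  unfold len form; fun_prop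

theorem InCone.form_self_nonpos {v : Mink n} (h : InCone v) : form v v ≤ 0 := by
  have := h.neg_form_nonneg h; linarith

theorem InCone.len_sq {v : Mink n} (h : InCone v) : len v ^ 2 = -form v v := by
  rw [len, Real.sq_sqrt (abs_nonneg _), abs_of_nonpos h.form_self_nonpos]

theorem len_smul {v : Mink n} {c : ℝ} (hc : 0 ≤ c) : len (c • v) = c * len v := by
  rw [len, form_smul_left, form_smul_right, ← mul_assoc, abs_mul, abs_of_nonneg (mul_self_nonneg c),
    Real.sqrt_mul (mul_self_nonneg c), Real.sqrt_mul_self hc, len]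

theorem IsFutureTimelike.len_pos {v : Mink n} (h : IsFutureTimelike v) : 0 < len v :=
  Real.sqrt_pos.2 (abs_pos.2 h.1.ne)

theorem InCone.isFutureTimelike_of_len_pos {v : Mink n} (h : InCone v) (h0 : 0 < len v) :
    IsFutureTimelike v := by
  have h1 : form v v < 0 := h.form_self_nonpos.lt_of_ne fun h1 => by simp [len, h1] at h0
  refine ⟨h1, ?_⟩
  rw [form_dt, neg_lt_zero]
  refine h.fst_nonneg.lt_of_ne fun h2 => ?_
  rw [form_self, ← h2] at h1
  nlinarith [norm_nonneg v.2]

/-- The reverse Cauchy–Schwarz inequality. -/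
theorem InCone.len_mul_len_le {v w : Mink n} (hv : InCone v) (hw : InCone w) :
    len v * len w ≤ -form v w := by
  refine le_trans ?_ (neg_form_ge (v := v) (w := w))
  have h1 := mul_le_mul hv hw (norm_nonneg _) hv.fst_nonneg
  refine abs_le_of_sq_le_sq' ?_ (by linarith) |>.2
  rw [mul_pow, hv.len_sq, hw.len_sq, form_self, form_self]
  nlinarith [sq_nonneg (v.1 * ‖w.2‖ - w.1 * ‖v.2‖)]

/-- The reverse triangle inequality. -/
theorem InCone.len_add_len_le {v w : Mink n} (hv : InCone v) (hw : InCone w) :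
    len v + len w ≤ len (v + w) := by
  refine abs_le_of_sq_le_sq' ?_ (len_nonneg _) |>.2
  rw [add_sq, hv.len_sq, hw.len_sq, (hv.add hw).len_sq, form_add_left, form_add_right,
    form_add_right, form_comm w v]
  linarith [hv.len_mul_len_le hw]

/-- A causal vector is the sum of two lightlike ones. -/
theorem InCone.exists_lightlike (hn : 1 ≤ n) {w : Mink n} (hw : InCone w) :
    ∃ (v₁ v₂ : Mink n) (α β : ℝ), IsFutureLightlike v₁ ∧ IsFutureLightlike v₂ ∧ 0 ≤ α ∧ 0 ≤ β ∧
      w = α • v₁ + β • v₂ := by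
  obtain ⟨e, he, hp⟩ : ∃ e : EuclideanSpace ℝ (Fin n), ‖e‖ = 1 ∧ w.2 = ‖w.2‖ • e := by
    by_cases h : w.2 = 0
    · exact ⟨EuclideanSpace.single ⟨0, hn⟩ 1, by simp, by simp [h]⟩
    · have h' := norm_ne_zero_iff.2 h
      exact ⟨‖w.2‖⁻¹ • w.2, by simp [norm_smul, h'], by simp [smul_smul, h']⟩
  have h1 : ‖w.2‖ ≤ w.1 := hw
  -- Null coordinates in the plane of `∂ₜ` and `e`; membership in the cone is what makes the second
  -- one nonnegative.
  refine ⟨(1, e), (1, -e), (w.1 + ‖w.2‖) / 2, (w.1 - ‖w.2‖) / 2, ⟨he, one_pos⟩,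
    ⟨by simpa using he, one_pos⟩, by linarith [norm_nonneg w.2], by linarith, ?_⟩
  refine Prod.ext ?_ ?_
  · simp; ring
  · simp only [Prod.snd_add, Prod.smul_snd, smul_neg, ← sub_eq_add_neg, ← sub_smul]
    rw [show (w.1 + ‖w.2‖) / 2 - (w.1 - ‖w.2‖) / 2 = ‖w.2‖ by ring]; exact hp

/-- Lets two causal steps, one up and one down, connect any two points of a future set. -/
theorem exists_common_future (x y : Mink n) :
    ∃ w w', InCone w ∧ InCone w' ∧ x + w = y + w' := by
  -- Both components of `y - x` are bounded by its sup norm, so twice that norm in time is enough.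
  refine ⟨(y - x) + (2 * ‖y - x‖) • dt, (2 * ‖y - x‖) • dt, ?_,
    isFutureTimelike_dt.inCone.smul (by positivity), by abel⟩
  have h1 := neg_le_of_abs_le (norm_fst_le (y - x))
  have h2 := norm_snd_le (y - x)
  change ‖(y - x).2 + (2 * ‖y - x‖) • (0 : EuclideanSpace ℝ (Fin n))‖ ≤
    (y - x).1 + 2 * ‖y - x‖ * 1
  rw [smul_zero, add_zero]
  linarith

/-- Every linear functional is represented by the Lorentzian form. -/
theorem exists_form_eq (φ : Mink n →L[ℝ] ℝ) : ∃ u : Mink n, ∀ x, φ x = -form u x := by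
  let ψ := φ.comp (ContinuousLinearMap.inr ℝ ℝ (EuclideanSpace ℝ (Fin n)))
  refine ⟨(φ (1, 0), -(InnerProductSpace.toDual ℝ _).symm ψ), fun x => ?_⟩
  have h : x = x.1 • ((1, 0) : Mink n) + (0, x.2) := by ext <;> simp
  have h2 : inner ℝ ((InnerProductSpace.toDual ℝ _).symm ψ) x.2 = φ (0, x.2) := by
    rw [InnerProductSpace.toDual_symm_apply]; simp [ψ]
  conv_lhs => rw [h, map_add, map_smul]
  simp only [form, inner_neg_left, h2, smul_eq_mul]
  ring

/-- The vector `(1, e)` with `e` along `u.2` minimizes the pairing with `u` among the null vectors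
`(1, e')`, so testing on lightlike vectors detects the cone. With `u = 0` it merely supplies a
future lightlike vector. -/
theorem exists_future_neg_form_eq (hn : 1 ≤ n) (u : Mink n) :
    ∃ v, IsFutureLightlike v ∧ -form u v = u.1 - ‖u.2‖ := by
  obtain ⟨e, he, hp⟩ : ∃ e : EuclideanSpace ℝ (Fin n), ‖e‖ = 1 ∧ u.2 = ‖u.2‖ • e := by
    by_cases h : u.2 = 0
    · exact ⟨EuclideanSpace.single ⟨0, hn⟩ 1, by simp, by simp [h]⟩
    · have h' := norm_ne_zero_iff.2 h
      exact ⟨‖u.2‖⁻¹ • u.2, by simp [norm_smul, h'], by simp [smul_smul, h']⟩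
  refine ⟨(1, e), ⟨he, one_pos⟩, ?_⟩
  have : inner ℝ u.2 e = ‖u.2‖ := by
    conv_lhs => rw [hp]
    rw [inner_smul_left, real_inner_self_eq_norm_sq, he]; simp
  simp only [form, this]; ring

theorem isFutureTimelike_of_neg_form_pos (hn : 1 ≤ n) {u : Mink n}
    (h : ∀ v, IsFutureLightlike v → 0 < -form u v) : IsFutureTimelike u := by
  obtain ⟨v, hv, he⟩ := exists_future_neg_form_eq hn u
  have := h v hv
  exact isFutureTimelike_iff.2 (by linarith)

/-- A vector which is nonnegative against the future lightlike vectors lies in the cone. -/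
theorem inCone_of_neg_form_nonneg (hn : 1 ≤ n) {u : Mink n}
    (h : ∀ v, IsFutureLightlike v → 0 ≤ -form u v) : InCone u := by
  obtain ⟨v, hv, he⟩ := exists_future_neg_form_eq hn u
  have := h v hv
  show ‖u.2‖ ≤ u.1
  linarith

/-! ### Curves -/

/-- The only fact about curves that needs calculus; causal relations then reduce to conditions on `y
- x`. -/
theorem JoinedBy.lt {P : Mink n → Prop} {Ω : Set (Mink n)} {x y : Mink n} (h : JoinedBy P Ω x y)
    (L : Mink n →L[ℝ] ℝ) (hL : ∀ v, P v → 0 < L v) : L x < L y := by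
  obtain ⟨γ, a, b, ⟨hab, N, s, hs, h0, hN, hγ⟩, -, rfl, rfl⟩ := h
  have key : StrictMono fun i => L (γ (s i)) := by
    refine Fin.strictMono_iff_lt_succ.2 fun i => ?_
    obtain ⟨hc, hd⟩ := hγ i
    have hlt : s i.castSucc < s i.succ := hs Fin.castSucc_lt_succ
    have hd1 : ∀ t ∈ Set.Icc (s i.castSucc) (s i.succ), HasDerivWithinAt (fun t => L (γ t))
        (L (derivWithin γ (Set.Icc (s i.castSucc) (s i.succ)) t))
        (Set.Icc (s i.castSucc) (s i.succ)) t := fun t ht =>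
      L.hasFDerivAt.comp_hasDerivWithinAt t
        ((hc.differentiableOn (by simp)) t ht).hasDerivWithinAt
    refine strictMonoOn_of_deriv_pos (convex_Icc _ _)
      (fun t ht => (hd1 t ht).continuousWithinAt) (fun t ht => ?_)
      (Set.left_mem_Icc.2 hlt.le) (Set.right_mem_Icc.2 hlt.le) hlt
    have ht' := interior_subset ht
    rw [((hd1 t ht').hasDerivAt (mem_interior_iff_mem_nhds.1 ht)).deriv]
    exact hL _ (hd t ht')
  have hpos : (0 : Fin (N + 1)) < Fin.last N := by
    rw [← hs.lt_iff_lt, h0, hN]; exact hab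
  simpa [h0, hN] using key hpos

/-- The functional `(t, p) ↦ t - ⟨e, p⟩`. -/
noncomputable def coFun (e : EuclideanSpace ℝ (Fin n)) : Mink n →L[ℝ] ℝ :=
  ContinuousLinearMap.fst ℝ _ _ - (innerSL ℝ e).comp (ContinuousLinearMap.snd ℝ _ _)

theorem coFun_apply (e : EuclideanSpace ℝ (Fin n)) (v : Mink n) :
    coFun e v = v.1 - inner ℝ e v.2 := by simp [coFun]

/-- The functionals `t - ⟨e, p⟩` with `‖e‖ < 1` are positive on future causal vectors, and jointly
they cut out the closed cone. -/
theorem JoinedBy.isFutureCausal {Ω : Set (Mink n)} {x y : Mink n}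
    (h : JoinedBy IsFutureCausal Ω x y) : IsFutureCausal (y - x) := by
  have key : ∀ e : EuclideanSpace ℝ (Fin n), ‖e‖ < 1 → inner ℝ e (y - x).2 < (y - x).1 := by
    intro e he
    have := h.lt (coFun e) fun v hv => by
      obtain ⟨h1, h2⟩ := isFutureCausal_iff.1 hv
      have h3 := real_inner_le_norm e v.2
      have h4 : ‖e‖ * ‖v.2‖ ≤ ‖e‖ * v.1 := mul_le_mul_of_nonneg_left h1 (norm_nonneg _)
      rw [coFun_apply]
      nlinarith
    rw [← sub_pos, ← map_sub, coFun_apply] at this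
    linarith
  refine isFutureCausal_iff.2 ⟨?_, by simpa using key 0 (by simp)⟩
  show ‖(y - x).2‖ ≤ (y - x).1
  rcases eq_or_ne (y - x).2 0 with h0 | h0
  · simpa [h0] using (key 0 (by simp)).le
  have h0' := norm_pos_iff.2 h0
  refine le_of_forall_lt fun c hc => ?_
  rcases lt_or_ge c 0 with hc0 | hc0
  · exact hc0.trans (by simpa using key 0 (by simp))
  -- This `e` has norm `c / ‖(y - x).2‖ < 1` and pairs with `(y - x).2` to `c`.
  have := key ((c / ‖(y - x).2‖ ^ 2) • (y - x).2) (by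
    rw [norm_smul, Real.norm_eq_abs, abs_of_nonneg (by positivity), div_mul_eq_mul_div,
      div_lt_one (by positivity)]
    nlinarith)
  rwa [inner_smul_left, real_inner_self_eq_norm_sq, conj_trivial,
    div_mul_cancel₀ _ (by positivity)] at this

theorem JoinedBy.isFutureTimelike {Ω : Set (Mink n)} {x y : Mink n}
    (h : JoinedBy IsFutureTimelike Ω x y) : IsFutureTimelike (y - x) := by
  have key : ∀ e : EuclideanSpace ℝ (Fin n), ‖e‖ ≤ 1 → inner ℝ e (y - x).2 < (y - x).1 := by
    intro e he
    have := h.lt (coFun e) fun v hv => by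
      have h1 := isFutureTimelike_iff.1 hv
      have h3 := real_inner_le_norm e v.2
      have h4 : ‖e‖ * ‖v.2‖ ≤ 1 * ‖v.2‖ := mul_le_mul_of_nonneg_right he (norm_nonneg _)
      rw [coFun_apply]
      linarith
    rw [← sub_pos, ← map_sub, coFun_apply] at this
    linarith
  rw [isFutureTimelike_iff]
  rcases eq_or_ne (y - x).2 0 with h0 | h0
  · simpa [h0] using key 0 (by simp)
  have h0' := norm_ne_zero_iff.2 h0
  have := key (‖(y - x).2‖⁻¹ • (y - x).2) (by rw [norm_smul, norm_inv, norm_norm, inv_mul_cancel₀ h0'])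
  rwa [inner_smul_left, real_inner_self_eq_norm_sq, conj_trivial, sq,
    inv_mul_cancel_left₀ h0'] at this

theorem isPiecewiseSmoothCurve_segment {P : Mink n → Prop} (x : Mink n) {w : Mink n} (hw : P w) :
    IsPiecewiseSmoothCurve P (fun t => x + t • w) 0 1 := by
  refine ⟨one_pos, 1, ![0, 1], ?_, rfl, rfl, fun i => ?_⟩
  · refine Fin.strictMono_iff_lt_succ.2 fun i => ?_
    fin_cases i; simp
  · have hd : ∀ t : ℝ, HasDerivAt (fun t : ℝ => x + t • w) w t := fun t => by
      simpa using ((hasDerivAt_id t).smul_const w).const_add x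
    fin_cases i
    refine ⟨ContDiff.contDiffOn (by fun_prop), fun t ht => ?_⟩
    rw [((hd t).hasDerivWithinAt).derivWithin (uniqueDiffOn_Icc (by simp) t ht)]
    exact hw

theorem joinedBy_segment {P : Mink n → Prop} {Ω : Set (Mink n)} {x y : Mink n} (hw : P (y - x))
    (h : segment ℝ x y ⊆ Ω) : JoinedBy P Ω x y := by
  refine ⟨_, 0, 1, isPiecewiseSmoothCurve_segment x hw, fun t ht => h ?_, by simp, by simp⟩
  rw [segment_eq_image']
  exact ⟨t, ht, rfl⟩

theorem mem_chronFuture {A : Set (Mink n)} {y : Mink n} :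
    y ∈ chronFuture A ↔ ∃ x ∈ A, IsFutureTimelike (y - x) :=
  exists_congr fun _ => and_congr_right fun _ =>
    ⟨JoinedBy.isFutureTimelike, fun h => joinedBy_segment h (Set.subset_univ _)⟩

theorem CausalLE.inCone {Ω : Set (Mink n)} {x y : Mink n} (h : CausalLE Ω x y) :
    InCone (y - x) := by
  rcases h with rfl | h
  · simpa using inCone_zero
  · exact (isFutureCausal_iff.1 h.isFutureCausal).1

theorem causalLE_of_inCone {Ω : Set (Mink n)} (hΩ : Convex ℝ Ω) {x y : Mink n} (hx : x ∈ Ω)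
    (hy : y ∈ Ω) (h : InCone (y - x)) : CausalLE Ω x y := by
  rcases eq_or_ne x y with rfl | hne
  · exact Or.inl rfl
  · exact Or.inr (joinedBy_segment (h.isFutureCausal (sub_ne_zero.2 hne.symm))
      (hΩ.segment_subset hx hy))

theorem mem_causalPast {x y : Mink n} : y ∈ causalPast x ↔ InCone (x - y) :=
  ⟨CausalLE.inCone, causalLE_of_inCone convex_univ trivial trivial⟩

end Mink

/-! ### Regular domains, supporting hyperplanes and the retraction to the boundary -/

namespace Mink

variable {n : ℕ}

/-- Nonempty open convex future sets without complete lightlike lines. -/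
structure IsRegular (Ω : Set (Mink n)) : Prop where
  isOpen : IsOpen Ω
  nonempty : Ω.Nonempty
  convex : Convex ℝ Ω
  add_mem : ∀ x ∈ Ω, ∀ w, InCone w → x + w ∈ Ω
  exists_notMem : ∀ x v, IsFutureLightlike v → ∃ s : ℝ, x + s • v ∉ Ω

theorem isRegular_of {Ω : Set (Mink n)} (hdom : IsSpacetimeDomain Ω) (hconv : Convex ℝ Ω)
    (hfut : IsFutureComplete Ω) (hline : ¬ ContainsLightlikeLine Ω) : IsRegular Ω where
  isOpen := hdom.1
  nonempty := hdom.2.1.nonempty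
  convex := hconv
  add_mem x hx w hw := by
    rcases eq_or_ne w 0 with rfl | h0
    · simpa using hx
    · simpa using hfut _ 0 1 (isPiecewiseSmoothCurve_segment x (hw.isFutureCausal h0))
        (by simpa using hx) 1 (by simp)
  exists_notMem x v hv := by
    by_contra! h
    exact hline ⟨x, v, hv.isLightlike, h⟩

namespace IsRegular

variable {Ω : Set (Mink n)}

theorem mem_of_sub (h : IsRegular Ω) {x y : Mink n} (hx : x ∈ Ω) (hw : InCone (y - x)) : y ∈ Ω := by
  simpa using h.add_mem x hx _ hw

/-- The chronological past of `r + w` is a neighbourhood of `r`, so it meets `Ω`. -/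
theorem closure_add_mem (h : IsRegular Ω) {r w : Mink n} (hr : r ∈ closure Ω)
    (hw : IsFutureTimelike w) : r + w ∈ Ω := by
  have ho : IsOpen {r' : Mink n | IsFutureTimelike (r + w - r')} :=
    isOpen_isFutureTimelike.preimage (by fun_prop)
  obtain ⟨r', h1, h2⟩ := mem_closure_iff.1 hr _ ho (by simpa using hw)
  exact h.mem_of_sub h2 (IsFutureTimelike.inCone h1)

theorem mem_of_closure (h : IsRegular Ω) {r x : Mink n} (hr : r ∈ closure Ω)
    (hw : IsFutureTimelike (x - r)) : x ∈ Ω := by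
  simpa using h.closure_add_mem hr hw

/-- Two points of the boundary are never timelike related. -/
theorem form_nonneg_of_boundary (h : IsRegular Ω) {r z : Mink n} (hr : r ∈ closure Ω)
    (hr' : r ∉ Ω) (hz : z ∈ closure Ω) (hz' : z ∉ Ω) : 0 ≤ form (r - z) (r - z) := by
  by_contra! hneg
  rcases lt_or_ge 0 (r - z).1 with h1 | h1
  · exact hr' (h.mem_of_closure hz ⟨hneg, by simpa [form_dt] using h1⟩)
  · refine hz' (h.mem_of_closure hr ?_)
    rw [isFutureTimelike_iff]
    rw [form_self, sub_neg] at hneg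
    have h2 := abs_lt_of_sq_lt_sq' (by rwa [neg_sq] : ‖(r - z).2‖ ^ 2 < (-(r - z).1) ^ 2)
      (by linarith)
    rw [← neg_sub r z, Prod.snd_neg, norm_neg, Prod.fst_neg]
    exact h2.2

/-- Hahn–Banach gives the half-space. Its conormal lies in the cone, since otherwise some future
lightlike direction, along which `Ω` is invariant, would lead out of the half-space. -/
theorem exists_support (h : IsRegular Ω) (hn : 1 ≤ n) {z : Mink n} (hz : z ∉ Ω) :
    ∃ u : Mink n, InCone u ∧ ∀ x ∈ Ω, 0 < -form u (x - z) := by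
  obtain ⟨φ, hφ⟩ := geometric_hahn_banach_point_open h.convex h.isOpen hz
  obtain ⟨u, hu⟩ := exists_form_eq φ
  have hu' : ∀ x ∈ Ω, 0 < -form u (x - z) := fun x hx => by
    rw [← hu, map_sub]; linarith [hφ x hx]
  refine ⟨u, inCone_of_neg_form_nonneg hn fun v hv => ?_, hu'⟩
  by_contra! hneg
  obtain ⟨x, hx⟩ := h.nonempty
  have h1 := hu' _ (h.add_mem x hx ((-form u (x - z) / form u v) • v)
    (hv.inCone.smul (div_nonneg (hu' x hx).le (by linarith))))
  have h2 : form u v ≠ 0 := by intro h; linarith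
  rw [add_sub_right_comm, form_add_right, form_smul_right, div_mul_cancel₀ _ h2] at h1
  linarith

/-- A regular set lies in the future of a spacelike hyperplane. -/
theorem exists_timelike_bound (h : IsRegular Ω) (hn : 1 ≤ n) :
    ∃ (u : Mink n) (c : ℝ), IsFutureTimelike u ∧ ∀ x ∈ Ω, c < -form u x := by
  obtain ⟨x₀, hx₀⟩ := h.nonempty
  obtain ⟨v₀, hv₀, -⟩ := exists_future_neg_form_eq hn (0 : Mink n)
  obtain ⟨s, hs⟩ := h.exists_notMem x₀ v₀ hv₀
  obtain ⟨u₁, hu₁, h₁⟩ := h.exists_support hn hs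
  have hpos : 0 < u₁.1 := hu₁.fst_nonneg.lt_of_ne fun h0 => by
    have h3 : ‖u₁.2‖ ≤ 0 := h0 ▸ hu₁
    have : u₁ = 0 := Prod.ext h0.symm (norm_le_zero_iff.1 h3)
    simpa [this, form] using h₁ x₀ hx₀
  rcases hu₁.lt_or_eq with ht | hl
  · refine ⟨u₁, -form u₁ (x₀ + s • v₀), isFutureTimelike_iff.2 ht, fun x hx => ?_⟩
    have := h₁ x hx
    rw [form_sub_right] at this
    linarith
  have hul : IsFutureLightlike u₁ := ⟨hl, hpos⟩
  -- When the first conormal is null, support `Ω` at a missing point of the line through `x₀` in the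
  -- direction `u₁` itself. The new conormal `u₂` cannot be orthogonal to `u₁`, so `u₁ + u₂` is
  -- timelike.
  obtain ⟨s', hs'⟩ := h.exists_notMem x₀ u₁ hul
  obtain ⟨u₂, hu₂, h₂⟩ := h.exists_support hn hs'
  have h12 : 0 < -form u₁ u₂ := by
    refine (hu₁.neg_form_nonneg hu₂).lt_of_ne fun h0 => ?_
    have := h₂ x₀ hx₀
    rw [sub_add_cancel_left, ← neg_smul, form_smul_right, form_comm] at this
    rw [neg_eq_zero.1 h0.symm] at this
    simp at this
  refine ⟨u₁ + u₂, -form u₁ (x₀ + s • v₀) + -form u₂ (x₀ + s' • u₁), ⟨?_, ?_⟩, fun x hx => ?_⟩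
  · rw [form_add_left, form_add_right, form_add_right, hul.form_self, form_comm u₂ u₁]
    linarith [hu₂.form_self_nonpos]
  · rw [form_dt, Prod.fst_add]; linarith [hu₂.fst_nonneg]
  · have e1 := h₁ x hx
    have e2 := h₂ x hx
    rw [form_sub_right] at e1 e2
    rw [form_add_left]
    linarith

/-- The Lorentzian distance to the boundary is realized. -/
theorem exists_isMaxOn (h : IsRegular Ω) (hn : 1 ≤ n) {x : Mink n} (hx : x ∈ Ω) :
    ∃ r ∈ closure Ω, r ∉ Ω ∧ IsFutureTimelike (x - r) ∧
      ∀ r' ∈ closure Ω, InCone (x - r') → len (x - r') ≤ len (x - r) := by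
  obtain ⟨u, c, hu, hc⟩ := h.exists_timelike_bound hn
  have hc' : ∀ r ∈ closure Ω, c ≤ -form u r := fun r hr => by
    have : IsClosed {r : Mink n | c ≤ -form u r} :=
      isClosed_le continuous_const (by unfold form; fun_prop)
    exact closure_minimal (fun y hy => (hc y hy).le) this hr
  have hδ : 0 < u.1 - ‖u.2‖ := by linarith [isFutureTimelike_iff.1 hu]
  let K := closure Ω ∩ {r | InCone (x - r)}
  have hK : IsClosed K := isClosed_closure.inter (isClosed_inCone.preimage (by fun_prop))
  -- On the cone, the pairing with `u` is at least `u.1 - ‖u.2‖ > 0` times the time component, which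
  -- in turn dominates the norm.
  have hKb : K ⊆ Metric.closedBall x ((-form u x - c) / (u.1 - ‖u.2‖)) := by
    rintro r ⟨hr, hr'⟩
    have hr' : ‖(x - r).2‖ ≤ (x - r).1 := hr'
    have h1 := hc' r hr
    have h2 := neg_form_ge (v := u) (w := x - r)
    rw [form_sub_right] at h2
    have h3 := mul_le_mul_of_nonneg_left hr' (norm_nonneg u.2)
    have h4 : (x - r).1 ≤ (-form u x - c) / (u.1 - ‖u.2‖) := by
      rw [le_div_iff₀ hδ]; linarith
    rw [Metric.mem_closedBall', dist_eq_norm, Prod.norm_def, sup_le_iff, Real.norm_eq_abs,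
      abs_of_nonneg ((norm_nonneg _).trans hr')]
    exact ⟨h4, hr'.trans h4⟩
  have hKc : IsCompact K := (isCompact_closedBall _ _).of_isClosed_subset hK hKb
  obtain ⟨r, ⟨hr, hrx⟩, hmax⟩ := hKc.exists_isMaxOn ⟨x, subset_closure hx, by simpa using inCone_zero⟩
    (f := fun r => len (x - r)) (continuous_len.comp (by fun_prop)).continuousOn
  have hmax' : ∀ r' ∈ closure Ω, InCone (x - r') → len (x - r') ≤ len (x - r) :=
    fun r' h1 h2 => hmax ⟨h1, h2⟩
  -- The maximum is positive because `x - ε • dt` is in `Ω` for small `ε`.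
  have htl : IsFutureTimelike (x - r) := by
    refine InCone.isFutureTimelike_of_len_pos hrx ?_
    have hcont : Filter.Tendsto (fun ε : ℝ => x - ε • (dt : Mink n)) (nhdsWithin 0 (Set.Ioi 0))
        (nhds x) := by
      have : Continuous fun ε : ℝ => x - ε • (dt : Mink n) := by fun_prop
      simpa using (this.tendsto 0).mono_left nhdsWithin_le_nhds
    obtain ⟨ε, h1, h2⟩ := ((hcont.eventually (h.isOpen.mem_nhds hx)).and self_mem_nhdsWithin).exists
    have h3 : IsFutureTimelike (x - (x - ε • (dt : Mink n))) := by
      simpa using isFutureTimelike_dt.smul h2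
    exact h3.len_pos.trans_le (hmax' _ (subset_closure h1) h3.inCone)
  refine ⟨r, hr, fun hrΩ => ?_, htl, hmax'⟩
  -- A maximizer inside `Ω` could be pushed further into the past along `x - r`, lengthening the
  -- segment.
  have hcont : Filter.Tendsto (fun ε : ℝ => r - ε • (x - r)) (nhdsWithin 0 (Set.Ioi 0))
      (nhds r) := by
    have : Continuous fun ε : ℝ => r - ε • (x - r) := by fun_prop
    simpa using (this.tendsto 0).mono_left nhdsWithin_le_nhds
  obtain ⟨ε, h1, h2⟩ := ((hcont.eventually (h.isOpen.mem_nhds hrΩ)).and self_mem_nhdsWithin).exists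
  have h2 : 0 < ε := h2
  have h3 : x - (r - ε • (x - r)) = (1 + ε) • (x - r) := by module
  have h4 := hmax' _ (subset_closure h1) (by
    rw [h3]; exact htl.inCone.smul (by linarith))
  rw [h3, len_smul (by linarith)] at h4
  nlinarith [htl.len_pos]

end IsRegular

/-! ### The cosmological time: finiteness and concavity -/

/-- The cosmological time as a real number. -/
noncomputable def tau (Ω : Set (Mink n)) (x : Mink n) : ℝ := (cosmologicalTime Ω x).toReal

namespace IsRegular

variable {Ω : Set (Mink n)}

/-- The supremum defining `τ` runs over `Ω` only; a point `r` of the closure is replaced by `r + ε •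
(x - r)`, at the cost of a factor `1 - ε`. -/
theorem ofReal_len_le (h : IsRegular Ω) {r x : Mink n} (hr : r ∈ closure Ω)
    (hw : InCone (x - r)) : ENNReal.ofReal (len (x - r)) ≤ cosmologicalTime Ω x := by
  rcases (len_nonneg (x - r)).eq_or_lt with h0 | h0
  · simp [← h0]
  have ht := hw.isFutureTimelike_of_len_pos h0
  have key : ∀ ε ∈ Set.Ioo (0 : ℝ) 1,
      ENNReal.ofReal ((1 - ε) * len (x - r)) ≤ cosmologicalTime Ω x := by
    intro ε hε
    have h1 : x - (r + ε • (x - r)) = (1 - ε) • (x - r) := by module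
    have h2 : 0 ≤ 1 - ε := by linarith [hε.2]
    rw [← len_smul h2, ← h1]
    exact le_iSup₂_of_le (r + ε • (x - r)) ⟨h.closure_add_mem hr (ht.smul hε.1),
      mem_causalPast.2 (h1 ▸ hw.smul h2)⟩ le_rfl
  have hcont : Continuous fun ε : ℝ => ENNReal.ofReal ((1 - ε) * len (x - r)) :=
    ENNReal.continuous_ofReal.comp (by fun_prop)
  have hl : Filter.Tendsto (fun ε : ℝ => ENNReal.ofReal ((1 - ε) * len (x - r)))
      (nhdsWithin 0 (Set.Ioi 0)) (nhds (ENNReal.ofReal (len (x - r)))) := by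
    simpa using (hcont.tendsto 0).mono_left nhdsWithin_le_nhds
  exact le_of_tendsto hl (Filter.mem_of_superset (Ioo_mem_nhdsGT one_pos) key)

theorem exists_retract (h : IsRegular Ω) (hn : 1 ≤ n) {x : Mink n} (hx : x ∈ Ω) :
    ∃ r ∈ closure Ω, r ∉ Ω ∧ IsFutureTimelike (x - r) ∧ tau Ω x = len (x - r) ∧
      cosmologicalTime Ω x = ENNReal.ofReal (len (x - r)) := by
  obtain ⟨r, hr, hr', ht, hmax⟩ := h.exists_isMaxOn hn hx
  have : cosmologicalTime Ω x = ENNReal.ofReal (len (x - r)) := by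
    refine le_antisymm (iSup₂_le fun y hy => ?_) (h.ofReal_len_le hr ht.inCone)
    exact ENNReal.ofReal_le_ofReal (hmax y (subset_closure hy.1) (mem_causalPast.1 hy.2))
  exact ⟨r, hr, hr', ht, by rw [tau, this, ENNReal.toReal_ofReal (len_nonneg _)], this⟩

theorem len_le_tau (h : IsRegular Ω) (hn : 1 ≤ n) {r x : Mink n} (hx : x ∈ Ω)
    (hr : r ∈ closure Ω) (hw : InCone (x - r)) : len (x - r) ≤ tau Ω x := by
  obtain ⟨r', -, -, -, h1, h2⟩ := h.exists_retract hn hx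
  have := h.ofReal_len_le hr hw
  rw [h2, ENNReal.ofReal_le_ofReal_iff (len_nonneg _)] at this
  rwa [h1]

theorem tau_pos (h : IsRegular Ω) (hn : 1 ≤ n) {x : Mink n} (hx : x ∈ Ω) : 0 < tau Ω x := by
  obtain ⟨r, -, -, h0, h1, -⟩ := h.exists_retract hn hx
  rw [h1]; exact h0.len_pos

theorem cosmologicalTime_pos_lt_top (h : IsRegular Ω) (hn : 1 ≤ n) {x : Mink n} (hx : x ∈ Ω) :
    0 < cosmologicalTime Ω x ∧ cosmologicalTime Ω x < ⊤ := by
  obtain ⟨r, -, -, h0, -, h1⟩ := h.exists_retract hn hx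
  rw [h1]
  exact ⟨ENNReal.ofReal_pos.2 h0.len_pos, ENNReal.ofReal_lt_top⟩

/-- The convex combination of two retracts lies in the closure, and the reverse triangle inequality
bounds its length to the combined point from below. -/
theorem concaveOn_tau (h : IsRegular Ω) (hn : 1 ≤ n) : ConcaveOn ℝ Ω (tau Ω) := by
  refine ⟨h.convex, fun x hx y hy a b ha hb hab => ?_⟩
  obtain ⟨r, hr, -, h0, h1, -⟩ := h.exists_retract hn hx
  obtain ⟨r', hr', -, h0', h1', -⟩ := h.exists_retract hn hy
  rw [h1, h1', smul_eq_mul, smul_eq_mul, ← len_smul ha, ← len_smul hb]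
  have e : a • x + b • y - (a • r + b • r') = a • (x - r) + b • (y - r') := by module
  refine ((h0.inCone.smul ha).len_add_len_le (h0'.inCone.smul hb)).trans ?_
  rw [← e]
  exact h.len_le_tau hn (h.convex hx hy ha hb hab) (h.convex.closure hr hr' ha hb hab)
    (e ▸ (h0.inCone.smul ha).add (h0'.inCone.smul hb))

theorem continuousOn_tau (h : IsRegular Ω) (hn : 1 ≤ n) : ContinuousOn (tau Ω) Ω :=
  (h.concaveOn_tau hn).continuousOn h.isOpen

end IsRegular

/-! ### Lightlike rays and the growth of the cosmological time along them -/

/-- `s ↦ z + s v`, `s > 0`, is an inextendible future lightlike geodesic of `Ω`. -/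
structure IsRay (Ω : Set (Mink n)) (z v : Mink n) : Prop where
  lightlike : IsFutureLightlike v
  notMem : z ∉ Ω
  mem : ∀ s : ℝ, 0 < s → z + s • v ∈ Ω

theorem IsRay.mem_closure {Ω : Set (Mink n)} {z v : Mink n} (hz : IsRay Ω z v) :
    z ∈ closure Ω := by
  have hcont : Filter.Tendsto (fun ε : ℝ => z + ε • v) (nhdsWithin 0 (Set.Ioi 0)) (nhds z) := by
    have : Continuous fun ε : ℝ => z + ε • v := by fun_prop
    simpa using (this.tendsto 0).mono_left nhdsWithin_le_nhds
  exact mem_closure_of_tendsto hcont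
    (Filter.mem_of_superset self_mem_nhdsWithin fun s hs => hz.mem s hs)

theorem IsRay.pos_of_mem {Ω : Set (Mink n)} {z v : Mink n} (hz : IsRay Ω z v) (h : IsRegular Ω)
    {s : ℝ} (hs : z + s • v ∈ Ω) : 0 < s := by
  by_contra! h0
  refine hz.notMem (h.mem_of_sub hs ?_)
  have : z - (z + s • v) = (-s) • v := by module
  rw [this]
  exact hz.lightlike.inCone.smul (by linarith)

namespace IsRegular

variable {Ω : Set (Mink n)}

/-- The parameters of the line that lie in `Ω` form an open up-set bounded below; `z` is the point
at its infimum. -/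
theorem exists_ray (h : IsRegular Ω) {x v : Mink n} (hx : x ∈ Ω) (hv : IsFutureLightlike v) :
    ∃ (z : Mink n) (s : ℝ), 0 < s ∧ IsRay Ω z v ∧ x = z + s • v := by
  let S := {s : ℝ | x + s • v ∈ Ω}
  have hSo : IsOpen S := h.isOpen.preimage (by fun_prop)
  have hup : ∀ s ∈ S, ∀ t, s ≤ t → t ∈ S := fun s hs t hst => by
    refine h.mem_of_sub hs ?_
    have : x + t • v - (x + s • v) = (t - s) • v := by module
    rw [this]; exact hv.inCone.smul (sub_nonneg.2 hst)
  obtain ⟨m, hm⟩ := h.exists_notMem x v hv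
  have h0 : (0 : ℝ) ∈ S := by simpa [S] using hx
  have hbdd : BddBelow S := ⟨m, fun s hs => le_of_not_gt fun hlt => hm (hup s hs m hlt.le)⟩
  have hinf : sInf S ∉ S := fun hmem => by
    obtain ⟨ε, hε, hb⟩ := Metric.isOpen_iff.1 hSo _ hmem
    have h1 : sInf S - ε / 2 ∈ S := hb (by
      rw [Metric.mem_ball, Real.dist_eq, abs_lt]; constructor <;> linarith)
    linarith [csInf_le hbdd h1]
  have hlt : sInf S < 0 := (csInf_le hbdd h0).lt_of_ne fun he => hinf (by rw [he]; exact h0)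
  refine ⟨x + sInf S • v, -sInf S, by linarith, ⟨hv, hinf, fun s hs => ?_⟩, by module⟩
  obtain ⟨t, ht, htl⟩ := exists_lt_of_csInf_lt ⟨0, h0⟩ (lt_add_of_pos_right (sInf S) hs)
  have := hup t ht _ htl.le
  rw [add_assoc, ← add_smul]; exact this

/-- The homothety of centre `z` and ratio `s / t` sends the retract of the farther point to a point
of the closure competing for the nearer one. -/
theorem tau_ray_le (h : IsRegular Ω) (hn : 1 ≤ n) {z v : Mink n} (hz : IsRay Ω z v) {s t : ℝ}
    (hs : 0 < s) (hst : s ≤ t) : s * tau Ω (z + t • v) ≤ t * tau Ω (z + s • v) := by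
  have ht := hs.trans_le hst
  obtain ⟨r, hr, -, h0, h1, -⟩ := h.exists_retract hn (hz.mem t ht)
  have hq : 0 ≤ s / t := by positivity
  have e : z + s • v - ((1 - s / t) • z + (s / t) • r) = (s / t) • (z + t • v - r) := by
    have : s = s / t * t := by field_simp
    conv_lhs => enter [1, 2]; rw [this]
    module
  have hmem : (1 - s / t) • z + (s / t) • r ∈ closure Ω :=
    h.convex.closure hz.mem_closure hr (sub_nonneg.2 (div_le_one_of_le₀ hst ht.le)) hq (by ring)
  have := h.len_le_tau hn (hz.mem s hs) hmem (e ▸ h0.inCone.smul hq)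
  rw [e, len_smul hq, ← h1, div_mul_eq_mul_div, div_le_iff₀ ht] at this
  linarith

/-- Keep the retract `r` of the nearer point as a competitor for the farther one. As `v` is null,
the squared length from `r` is affine in the parameter, with constant term `-form (r - z) (r - z) ≤
0` because `r` and `z` both lie on the boundary. -/
theorem tau_sq_ray_le (h : IsRegular Ω) (hn : 1 ≤ n) {z v : Mink n} (hz : IsRay Ω z v) {s t : ℝ}
    (hs : 0 < s) (hst : s ≤ t) : t * tau Ω (z + s • v) ^ 2 ≤ s * tau Ω (z + t • v) ^ 2 := by
  have ht := hs.trans_le hst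
  obtain ⟨r, hr, hr', h0, h1, -⟩ := h.exists_retract hn (hz.mem s hs)
  have hb := h.form_nonneg_of_boundary hr hr' hz.mem_closure hz.notMem
  have hc : InCone (z + t • v - r) := by
    have : z + t • v - r = (z + s • v - r) + (t - s) • v := by module
    rw [this]; exact h0.inCone.add (hz.lightlike.inCone.smul (sub_nonneg.2 hst))
  have h2 := h.len_le_tau hn (hz.mem t ht) hr hc
  have e : ∀ s : ℝ, -form (z + s • v - r) (z + s • v - r) =
      2 * s * form v (r - z) - form (r - z) (r - z) := fun s => by
    rw [show z + s • v - r = s • v - (r - z) by module]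
    generalize r - z = w
    rw [form_sub_left, form_sub_right, form_sub_right, form_smul_left, form_smul_left,
      form_smul_right, form_smul_right, form_comm w v, hz.lightlike.form_self]
    ring
  have h3 : len (z + t • v - r) ^ 2 ≤ tau Ω (z + t • v) ^ 2 :=
    pow_le_pow_left₀ (len_nonneg _) h2 2
  rw [hc.len_sq, e] at h3
  rw [h1, h0.inCone.len_sq, e]
  nlinarith [mul_le_mul_of_nonneg_left h3 hs.le]

theorem tau_ray_lt (h : IsRegular Ω) (hn : 1 ≤ n) {z v : Mink n} (hz : IsRay Ω z v) {s t : ℝ}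
    (hs : 0 < s) (hst : s < t) : tau Ω (z + s • v) < tau Ω (z + t • v) := by
  have h1 := h.tau_sq_ray_le hn hz hs hst.le
  have h2 := h.tau_pos hn (hz.mem s hs)
  refine lt_of_pow_lt_pow_left₀ 2 (h.tau_pos hn (hz.mem t (hs.trans hst))).le ?_
  have : 0 < tau Ω (z + s • v) ^ 2 := by positivity
  nlinarith

theorem tau_lightlike_lt (h : IsRegular Ω) (hn : 1 ≤ n) {x v : Mink n} (hx : x ∈ Ω)
    (hv : IsFutureLightlike v) {a : ℝ} (ha : 0 < a) : tau Ω x < tau Ω (x + a • v) := by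
  obtain ⟨z, s, hs, hz, rfl⟩ := h.exists_ray hx hv
  rw [add_assoc, ← add_smul]
  exact h.tau_ray_lt hn hz hs (by linarith)

theorem tau_lightlike_le (h : IsRegular Ω) (hn : 1 ≤ n) {x v : Mink n} (hx : x ∈ Ω)
    (hv : IsFutureLightlike v) {a : ℝ} (ha : 0 ≤ a) : tau Ω x ≤ tau Ω (x + a • v) := by
  rcases ha.eq_or_lt with rfl | ha
  · simp
  · exact (h.tau_lightlike_lt hn hx hv ha).le

theorem tau_lt (h : IsRegular Ω) (hn : 1 ≤ n) {x y : Mink n} (hx : x ∈ Ω)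
    (hw : InCone (y - x)) (hne : x ≠ y) : tau Ω x < tau Ω y := by
  obtain ⟨v₁, v₂, α, β, h1, h2, hα, hβ, he⟩ := hw.exists_lightlike hn
  have hy : y = x + α • v₁ + β • v₂ := by rw [add_assoc, ← he]; abel
  have hm := h.add_mem x hx _ (h1.inCone.smul hα)
  rcases hα.eq_or_lt with rfl | hα
  · rcases hβ.eq_or_lt with rfl | hβ
    · simp [hy] at hne
    · simpa [hy] using h.tau_lightlike_lt hn hx h2 hβ
  · rw [hy]
    exact (h.tau_lightlike_lt hn hx h1 hα).trans_le (h.tau_lightlike_le hn hm h2 hβ)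

theorem logTime_eq (x : Mink n) : logTime Ω x = Real.log (tau Ω x) := rfl

theorem logTime_mono (h : IsRegular Ω) (hn : 1 ≤ n) {x y : Mink n} (hx : x ∈ Ω)
    (hw : InCone (y - x)) : logTime Ω x ≤ logTime Ω y := by
  rcases eq_or_ne x y with rfl | hne
  · rfl
  · exact Real.log_le_log (h.tau_pos hn hx) (h.tau_lt hn hx hw hne).le

theorem isTimeFunction (h : IsRegular Ω) (hn : 1 ≤ n) : IsTimeFunction Ω (logTime Ω) := by
  refine ⟨(h.continuousOn_tau hn).log fun x hx => (h.tau_pos hn hx).ne', fun x y hxy => ?_⟩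
  have hc := isFutureCausal_iff.1 hxy.isFutureCausal
  have hx : x ∈ Ω := by
    obtain ⟨γ, a, b, hab, hm, rfl, -⟩ := hxy
    exact hm a (Set.left_mem_Icc.2 hab.1.le)
  refine Real.log_lt_log (h.tau_pos hn hx) (h.tau_lt hn hx hc.1 fun he => ?_)
  simp [he] at hc

/-- A property which propagates along lightlike rays holds everywhere if it holds somewhere. -/
theorem ray_induction (h : IsRegular Ω) (hn : 1 ≤ n) {Q : Mink n → Prop}
    (hQ : ∀ z v, IsRay Ω z v → ∀ s t : ℝ, 0 < s → 0 < t → Q (z + s • v) → Q (z + t • v))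
    {x y : Mink n} (hx : x ∈ Ω) (hy : y ∈ Ω) (hQx : Q x) : Q y := by
  have step : ∀ x ∈ Ω, ∀ v, IsFutureLightlike v → ∀ a : ℝ, 0 ≤ a → (Q x ↔ Q (x + a • v)) := by
    intro x hx v hv a ha
    obtain ⟨z, s, hs, hz, rfl⟩ := h.exists_ray hx hv
    rw [add_assoc, ← add_smul]
    exact ⟨hQ z v hz _ _ hs (by linarith), hQ z v hz _ _ (by linarith) hs⟩
  have step2 : ∀ x ∈ Ω, ∀ w, InCone w → (Q x ↔ Q (x + w)) := by
    intro x hx w hw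
    obtain ⟨v₁, v₂, α, β, h1, h2, hα, hβ, rfl⟩ := hw.exists_lightlike hn
    rw [step x hx v₁ h1 α hα,
      step _ (h.add_mem x hx _ (h1.inCone.smul hα)) v₂ h2 β hβ, add_assoc]
  obtain ⟨w, w', hw, hw', e⟩ := exists_common_future x y
  rw [step2 y hy w' hw', ← e, ← step2 x hx w hw]
  exact hQx

end IsRegular

end Mink

namespace Mink

variable {n : ℕ}

/-! ### Projective parameters -/

theorem rhoI_comm (s t : ℝ) : rhoI s t = rhoI t s := by
  rw [rhoI, rhoI, ← abs_neg, ← Real.log_inv, inv_div, mul_comm (t - 1), mul_comm (t + 1)]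

/-- The two terms are the extreme logarithmic variations of positive affine functions on `I`,
attained by `1 + σ` and `1 - σ`. -/
theorem rhoI_eq {s t : ℝ} (hs : s ∈ baseInterval) (ht : t ∈ baseInterval) (hst : s ≤ t) :
    rhoI s t = Real.log ((1 + t) / (1 + s)) - Real.log ((1 - t) / (1 - s)) := by
  have h1 : 0 < 1 + s := by linarith [hs.1]
  have h2 : 0 < 1 - s := by linarith [hs.2]
  have h3 : 0 < 1 + t := by linarith [ht.1]
  have h4 : 0 < 1 - t := by linarith [ht.2]
  have e : (s - 1) * (t + 1) / ((s + 1) * (t - 1)) = ((1 + t) / (1 + s)) / ((1 - t) / (1 - s)) := by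
    have h5 : t - 1 ≠ 0 := by linarith
    have h6 : s + 1 ≠ 0 := by linarith
    field_simp
    ring
  rw [rhoI, e, Real.log_div (by positivity) (by positivity), abs_of_nonneg]
  rw [sub_nonneg]
  refine Real.log_le_log (by positivity) ?_
  rw [div_le_div_iff₀ h2 h1]
  nlinarith

/-- An affine function which is positive on `(-1, 1)` has bounded logarithmic variation. -/
theorem log_affine_mem {F₀ F₁ : ℝ} (hF : ∀ σ ∈ baseInterval, 0 < F₀ + F₁ * σ) {s t : ℝ}
    (hs : s ∈ baseInterval) (ht : t ∈ baseInterval) (hst : s ≤ t) :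
    Real.log (F₀ + F₁ * t) - Real.log (F₀ + F₁ * s) ≤ Real.log ((1 + t) / (1 + s)) ∧
    Real.log ((1 - t) / (1 - s)) ≤ Real.log (F₀ + F₁ * t) - Real.log (F₀ + F₁ * s) := by
  have h1 : 0 < 1 + s := by linarith [hs.1]
  have h2 : 0 < 1 - s := by linarith [hs.2]
  have h3 : 0 < 1 + t := by linarith [ht.1]
  have h4 : 0 < 1 - t := by linarith [ht.2]
  -- By continuity the function is nonnegative at `±1`; these two inequalities are all that is
  -- needed.
  have hc : IsClosed {σ : ℝ | 0 ≤ F₀ + F₁ * σ} := isClosed_le continuous_const (by fun_prop)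
  have hcl : ∀ σ ∈ closure baseInterval, 0 ≤ F₀ + F₁ * σ :=
    closure_minimal (fun σ hσ => (hF σ hσ).le) hc
  rw [baseInterval, closure_Ioo (by norm_num)] at hcl
  have e1 := hcl 1 (by norm_num)
  have e2 := hcl (-1) (by norm_num)
  have hFs := hF s hs
  have hFt := hF t ht
  rw [← Real.log_div hFt.ne' hFs.ne']
  constructor
  · refine Real.log_le_log (by positivity) ?_
    rw [div_le_div_iff₀ hFs h1]
    nlinarith
  · refine Real.log_le_log (by positivity) ?_
    rw [div_le_div_iff₀ h2 hFs]
    nlinarith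

/-- The variations of numerator and denominator lie in one interval of length `rhoI s t`, so their
difference is at most that length. -/
theorem abs_log_div_le_rhoI {F₀ F₁ D₀ D₁ : ℝ} (hF : ∀ σ ∈ baseInterval, 0 < F₀ + F₁ * σ)
    (hD : ∀ σ ∈ baseInterval, 0 < D₀ + D₁ * σ) {s t : ℝ}
    (hs : s ∈ baseInterval) (ht : t ∈ baseInterval) :
    |Real.log ((F₀ + F₁ * t) / (D₀ + D₁ * t)) - Real.log ((F₀ + F₁ * s) / (D₀ + D₁ * s))| ≤
      rhoI s t := by
  wlog hst : s ≤ t generalizing s t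
  · rw [abs_sub_comm, rhoI_comm]
    exact this ht hs (le_of_not_ge hst)
  obtain ⟨h1, h2⟩ := log_affine_mem hF hs ht hst
  obtain ⟨h3, h4⟩ := log_affine_mem hD hs ht hst
  rw [rhoI_eq hs ht hst, Real.log_div (hF t ht).ne' (hD t ht).ne',
    Real.log_div (hF s hs).ne' (hD s hs).ne', abs_le]
  constructor <;> linarith

/-- A function with vanishing Schwarzian derivative is projective. -/
theorem exists_projective {J : Set ℝ} {u : ℝ → ℝ} (hJ : IsOpen J) (hJc : J.OrdConnected)
    (hu : ContDiffOn ℝ ∞ u J) (hu' : ∀ t ∈ J, deriv u t ≠ 0)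
    (hS : ∀ t ∈ J, schwarzian u t = 0) (hne : J.Nonempty) :
    ∃ c d : ℝ, (∀ t ∈ J, 0 < c * t + d) ∧ ∀ φ₀ φ₁ : ℝ, ∃ F₀ F₁ : ℝ, ∀ t ∈ J,
      (φ₀ + φ₁ * t) / (c * t + d) = F₀ + F₁ * u t := by
  obtain ⟨t₀, ht₀⟩ := hne
  have hJp : IsPreconnected J := hJc.isPreconnected
  have hconst : ∀ f : ℝ → ℝ, (∀ t ∈ J, HasDerivAt f 0 t) → ∀ t ∈ J, f t = f t₀ := fun f hf t ht =>
    hJ.is_const_of_deriv_eq_zero hJp (fun t ht => (hf t ht).differentiableAt.differentiableWithinAt)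
      (fun t ht => (hf t ht).deriv) ht ht₀
  have hu1 : ContDiffOn ℝ ∞ (deriv u) J := hu.deriv_of_isOpen hJ (by simp)
  have hu2 : ContDiffOn ℝ ∞ (deriv (deriv u)) J := hu1.deriv_of_isOpen hJ (by simp)
  have hder : ∀ f : ℝ → ℝ, ContDiffOn ℝ ∞ f J → ∀ t ∈ J, HasDerivAt f (deriv f t) t :=
    fun f hf t ht => ((hf.differentiableOn (by simp)).differentiableAt (hJ.mem_nhds ht)).hasDerivAt
  have hS' : ∀ t ∈ J, deriv (deriv (deriv u)) t * deriv u t =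
      3 / 2 * deriv (deriv u) t ^ 2 := fun t ht => by
    have h1 := hS t ht
    have h2 := hu' t ht
    rw [schwarzian, iteratedDeriv_succ, iteratedDeriv_succ, iteratedDeriv_one] at h1
    field_simp at h1
    linarith
  obtain ⟨ε, hε, hpos⟩ : ∃ ε : ℝ, (ε = 1 ∨ ε = -1) ∧ ∀ t ∈ J, 0 < ε * deriv u t := by
    rcases lt_or_gt_of_ne (hu' t₀ ht₀) with h | h
    · refine ⟨-1, Or.inr rfl, fun t ht => ?_⟩
      by_contra! hcon
      obtain ⟨s, hs, hs0⟩ := hJp.intermediate_value ht₀ ht hu1.continuousOn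
        (Set.mem_Icc.2 ⟨h.le, by linarith⟩)
      exact hu' s hs hs0
    · refine ⟨1, Or.inl rfl, fun t ht => ?_⟩
      by_contra! hcon
      obtain ⟨s, hs, hs0⟩ := hJp.intermediate_value ht ht₀ hu1.continuousOn
        (Set.mem_Icc.2 ⟨by linarith, h.le⟩)
      exact hu' s hs hs0
  have hεε : ε * ε = 1 := by rcases hε with rfl | rfl <;> norm_num
  -- Classically `w = |u'|^(-1/2)` solves `w'' = -(1/2) S(u) w`, so here `w` is affine.
  let w : ℝ → ℝ := fun t => (√(ε * deriv u t))⁻¹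
  let w' : ℝ → ℝ := fun t => -(1 / 2) * (deriv (deriv u) t / deriv u t) * w t
  have hwpos : ∀ t ∈ J, 0 < w t := fun t ht => inv_pos.2 (Real.sqrt_pos.2 (hpos t ht))
  have hwsq : ∀ t ∈ J, deriv u t * w t ^ 2 = ε := fun t ht => by
    have h1 := hpos t ht
    have h2 := hu' t ht
    simp only [w, inv_pow, Real.sq_sqrt h1.le]
    rw [mul_inv, ← mul_assoc, mul_comm _ ε⁻¹, mul_assoc, mul_inv_cancel₀ h2, mul_one]
    exact inv_eq_of_mul_eq_one_right hεε
  have hw : ∀ t ∈ J, HasDerivAt w (w' t) t := fun t ht => by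
    have h1 := hpos t ht
    have h2 := hu' t ht
    have h3 := (((hder _ hu1 t ht).const_mul ε).sqrt h1.ne').inv (Real.sqrt_pos.2 h1).ne'
    refine h3.congr_deriv ?_
    simp only [w', w]
    have h4 : √(ε * deriv u t) ≠ 0 := (Real.sqrt_pos.2 h1).ne'
    rw [Real.sq_sqrt h1.le]
    have h5 : ε ≠ 0 := left_ne_zero_of_mul h1.ne'
    field_simp
  have hw2 : ∀ t ∈ J, HasDerivAt w' 0 t := fun t ht => by
    have h2 := hu' t ht
    have h3 := (((hder _ hu2 t ht).div (hder _ hu1 t ht) h2).const_mul (-(1 / 2))).mul (hw t ht)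
    refine h3.congr_deriv ?_
    simp only [w', Pi.div_apply]
    have := hS' t ht
    generalize w t = W
    field_simp
    linear_combination (-2 * W) * this
  have hw'c := hconst w' hw2
  have hwa : ∀ t ∈ J, w t - w' t₀ * t = w t₀ - w' t₀ * t₀ := hconst _ fun t ht => by
    have := (hw t ht).sub ((hasDerivAt_id t).const_mul (w' t₀))
    refine this.congr_deriv ?_
    rw [hw'c t ht]; ring
  set c := w' t₀
  set d := w t₀ - c * t₀ with hd
  have hcd : ∀ t ∈ J, w t = c * t + d := fun t ht => by linarith [hwa t ht]
  have hW0 := hwpos t₀ ht₀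
  -- Both sides vanish at `t₀` and have derivative `w t₀ / w² = ε * w t₀ * u'`.
  have hu_eq : ∀ t ∈ J, (t - t₀) / (c * t + d) = ε * w t₀ * (u t - u t₀) := by
    have h1 : ∀ t ∈ J, ε * w t₀ * u t - (t - t₀) / (c * t + d) =
        ε * w t₀ * u t₀ - (t₀ - t₀) / (c * t₀ + d) := hconst _ fun t ht => by
      have h2 : c * t + d ≠ 0 := by rw [← hcd t ht]; exact (hwpos t ht).ne'
      have h3 := ((hder u hu t ht).const_mul (ε * w t₀)).sub
        (((hasDerivAt_id t).sub_const t₀).div (((hasDerivAt_id t).const_mul c).add_const d) h2)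
      refine h3.congr_deriv ?_
      have h4 := hwsq t ht
      rw [hcd t ht] at h4
      simp only [id]
      rw [sub_eq_zero, eq_div_iff (pow_ne_zero 2 h2)]
      have h5 : w t₀ = c * t₀ + d := hcd t₀ ht₀
      linear_combination ε * w t₀ * h4 + w t₀ * hεε + h5
    intro t ht
    have := h1 t ht
    rw [sub_self, zero_div] at this
    linarith
  refine ⟨c, d, fun t ht => hcd t ht ▸ hwpos t ht, fun φ₀ φ₁ => ?_⟩
  -- Expand the numerator in the basis `c * t + d`, `t - t₀`; `A` matches the values at `t₀`.
  set A := (φ₀ + φ₁ * t₀) / w t₀ with hA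
  set B := (φ₁ - A * c) * (ε * w t₀) with hB
  refine ⟨A - B * u t₀, B, fun t ht => ?_⟩
  have h2 : c * t + d ≠ 0 := by rw [← hcd t ht]; exact (hwpos t ht).ne'
  have h3 : A * (c * t₀ + d) = φ₀ + φ₁ * t₀ := by
    rw [← hcd t₀ ht₀, hA, div_mul_cancel₀ _ hW0.ne']
  have h4 : φ₀ + φ₁ * t = A * (c * t + d) + (φ₁ - A * c) * (t - t₀) := by
    linear_combination -h3
  rw [h4, add_div, mul_div_cancel_right₀ _ h2, mul_div_assoc, hu_eq t ht, hB]
  ring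

/-- Positive affine functions have logarithmic variation at most `rhoI` in a projective
parameter. -/
theorem abs_log_affine_le_rhoI {J : Set ℝ} {u : ℝ → ℝ} (hJ : IsOpen J) (hJc : J.OrdConnected)
    (hu : ContDiffOn ℝ ∞ u J) (hu' : ∀ t ∈ J, deriv u t ≠ 0)
    (hS : ∀ t ∈ J, schwarzian u t = 0) (hb : Set.BijOn u J baseInterval) {φ₀ φ₁ : ℝ}
    (hφ : ∀ t ∈ J, 0 < φ₀ + φ₁ * t) {s t : ℝ} (hs : s ∈ J) (ht : t ∈ J) :
    |Real.log (φ₀ + φ₁ * t) - Real.log (φ₀ + φ₁ * s)| ≤ rhoI (u s) (u t) := by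
  obtain ⟨c, d, hcd, hF⟩ := exists_projective hJ hJc hu hu' hS ⟨s, hs⟩
  -- Divided by `c * t + d`, both `1` and the given function become affine in `u`; their quotient
  -- recovers that function.
  obtain ⟨D₀, D₁, hD⟩ := hF 1 0
  obtain ⟨F₀, F₁, hF⟩ := hF φ₀ φ₁
  have hFp : ∀ σ ∈ baseInterval, 0 < F₀ + F₁ * σ := fun σ hσ => by
    obtain ⟨t, ht, rfl⟩ := hb.surjOn hσ
    rw [← hF t ht]; exact div_pos (hφ t ht) (hcd t ht)
  have hDp : ∀ σ ∈ baseInterval, 0 < D₀ + D₁ * σ := fun σ hσ => by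
    obtain ⟨t, ht, rfl⟩ := hb.surjOn hσ
    rw [← hD t ht]; exact div_pos (by simp) (hcd t ht)
  have e : ∀ t ∈ J, φ₀ + φ₁ * t = (F₀ + F₁ * u t) / (D₀ + D₁ * u t) := fun t ht => by
    rw [← hF t ht, ← hD t ht, zero_mul, add_zero, one_div, div_inv_eq_mul,
      div_mul_cancel₀ _ (hcd t ht).ne']
  rw [e s hs, e t ht]
  exact abs_log_div_le_rhoI hFp hDp (hb.mapsTo hs) (hb.mapsTo ht)

/-- The projective parameter of a half-line. -/
noncomputable def rayParam (t : ℝ) : ℝ := (t - 1) / (t + 1)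

theorem rayParam_mem {t : ℝ} (ht : 0 < t) : rayParam t ∈ baseInterval := by
  have h : 0 < t + 1 := by linarith
  exact ⟨by rw [rayParam, lt_div_iff₀ h]; linarith, by rw [rayParam, div_lt_one h]; linarith⟩

theorem rayParam_left_inv {t : ℝ} (ht : 0 < t) : (1 + rayParam t) / (1 - rayParam t) = t := by
  have h : t + 1 ≠ 0 := by linarith
  rw [rayParam, one_add_div h, one_sub_div h, div_div_div_cancel_right₀ h]
  ring_nf

theorem rhoI_rayParam {s t : ℝ} (hs : 0 < s) (ht : 0 < t) :
    rhoI (rayParam s) (rayParam t) = |Real.log (t / s)| := by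
  have h1 : s + 1 ≠ 0 := by linarith
  have h2 : t + 1 ≠ 0 := by linarith
  have e1 : rayParam s - 1 = -2 / (s + 1) := by rw [rayParam]; field_simp; ring
  have e2 : rayParam t - 1 = -2 / (t + 1) := by rw [rayParam]; field_simp; ring
  have e3 : rayParam s + 1 = 2 * s / (s + 1) := by rw [rayParam]; field_simp; ring
  have e4 : rayParam t + 1 = 2 * t / (t + 1) := by rw [rayParam]; field_simp; ring
  rw [rhoI, e1, e2, e3, e4]
  congr 2
  field_simp

theorem hasDerivAt_inv_pow {t : ℝ} (ht : 0 < t) (c : ℝ) (k : ℕ) :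
    HasDerivAt (fun t => c * ((t + 1) ^ k)⁻¹) (-(c * k) * ((t + 1) ^ (k + 1))⁻¹) t := by
  have h : t + 1 ≠ 0 := by linarith
  have := ((((hasDerivAt_id t).add_const 1).pow k).inv (pow_ne_zero k h)).const_mul c
  refine this.congr_deriv ?_
  rcases k with _ | k
  · simp
  · simp only [id, Nat.add_sub_cancel, mul_one, Pi.pow_apply]
    field_simp
    ring

theorem deriv_rayParam {t : ℝ} (ht : 0 < t) : deriv rayParam t = 2 * ((t + 1) ^ 2)⁻¹ := by
  have h : rayParam =ᶠ[nhds t] fun t => 1 + (-2) * ((t + 1) ^ 1)⁻¹ := by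
    filter_upwards [Ioi_mem_nhds ht] with s hs
    have : s + 1 ≠ 0 := by linarith [Set.mem_Ioi.1 hs]
    rw [rayParam]; field_simp; ring
  rw [h.deriv_eq, ((hasDerivAt_inv_pow ht (-2) 1).const_add 1).deriv]
  simp

theorem deriv2_rayParam {t : ℝ} (ht : 0 < t) :
    deriv (deriv rayParam) t = -4 * ((t + 1) ^ 3)⁻¹ := by
  have h : deriv rayParam =ᶠ[nhds t] fun t => 2 * ((t + 1) ^ 2)⁻¹ := by
    filter_upwards [Ioi_mem_nhds ht] with s hs using deriv_rayParam hs
  rw [h.deriv_eq, (hasDerivAt_inv_pow ht 2 2).deriv]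
  norm_num

theorem deriv3_rayParam {t : ℝ} (ht : 0 < t) :
    deriv (deriv (deriv rayParam)) t = 12 * ((t + 1) ^ 4)⁻¹ := by
  have h : deriv (deriv rayParam) =ᶠ[nhds t] fun t => -4 * ((t + 1) ^ 3)⁻¹ := by
    filter_upwards [Ioi_mem_nhds ht] with s hs using deriv2_rayParam hs
  rw [h.deriv_eq, (hasDerivAt_inv_pow ht (-4) 3).deriv]
  norm_num

theorem IsRay.isPPL {Ω : Set (Mink n)} {z v : Mink n} (hz : IsRay Ω z v) :
    IsPPL Ω fun σ => z + ((1 + σ) / (1 - σ)) • v := by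
  refine ⟨Set.Ioi 0, z, v, rayParam, isOpen_Ioi, Set.ordConnected_Ioi, hz.lightlike.isLightlike,
    fun t ht => hz.mem t ht, ?_, fun t ht => ?_, fun t ht => ?_, ?_, fun t ht => ?_⟩
  · intro t ht
    have : t + 1 ≠ 0 := by linarith [Set.mem_Ioi.1 ht]
    have h1 : ContDiffAt ℝ ∞ (fun t : ℝ => t - 1) t := by fun_prop
    have h2 : ContDiffAt ℝ ∞ (fun t : ℝ => t + 1) t := by fun_prop
    exact (h1.div h2 this).contDiffWithinAt
  · have h : t + 1 ≠ 0 := by linarith [Set.mem_Ioi.1 ht]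
    rw [deriv_rayParam ht]; positivity
  · have h : t + 1 ≠ 0 := by linarith [Set.mem_Ioi.1 ht]
    rw [schwarzian, iteratedDeriv_succ, iteratedDeriv_succ, iteratedDeriv_one,
      deriv3_rayParam ht, deriv2_rayParam ht, deriv_rayParam ht]
    field_simp
    norm_num
  · refine ⟨fun t ht => rayParam_mem ht, fun s hs t ht hst => ?_, fun σ hσ => ?_⟩
    · rw [← rayParam_left_inv hs, ← rayParam_left_inv ht, hst]
    · have h1 : 0 < 1 + σ := by linarith [hσ.1]
      have h2 : 0 < 1 - σ := by linarith [hσ.2]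
      refine ⟨(1 + σ) / (1 - σ), div_pos h1 h2, ?_⟩
      rw [rayParam, div_sub_one h2.ne', div_add_one h2.ne', div_div_div_cancel_right₀ h2.ne']
      ring_nf
  · simp only [rayParam_left_inv ht]

end Mink

namespace Mink

variable {n : ℕ} {Ω : Set (Mink n)}

/-! ### Chains -/

/-- `y` is reached from `x` by a lightlike chain of length `S`. -/
inductive LightlikeReach (Ω : Set (Mink n)) : Mink n → Mink n → ℝ → Prop
  | single {γ : ℝ → Mink n} {s t : ℝ} (h : IsPPL Ω γ) (hs : s ∈ baseInterval)
      (ht : t ∈ baseInterval) : LightlikeReach Ω (γ s) (γ t) (rhoI s t)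
  | cons {γ : ℝ → Mink n} {s t : ℝ} {y : Mink n} {S : ℝ} (h : IsPPL Ω γ)
      (hs : s ∈ baseInterval) (ht : t ∈ baseInterval) (hy : LightlikeReach Ω (γ t) y S) :
      LightlikeReach Ω (γ s) y (rhoI s t + S)

theorem LightlikeReach.trans {x y z : Mink n} {S T : ℝ} (h : LightlikeReach Ω x y S)
    (h' : LightlikeReach Ω y z T) : LightlikeReach Ω x z (S + T) := by
  induction h with
  | single h hs ht => exact .cons h hs ht h'
  | cons h hs ht _ ih => rw [add_assoc]; exact .cons h hs ht (ih h')

theorem LightlikeReach.symm {x y : Mink n} {S : ℝ} (h : LightlikeReach Ω x y S) :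
    LightlikeReach Ω y x S := by
  induction h with
  | single h hs ht => rw [rhoI_comm]; exact .single h ht hs
  | cons h hs ht _ ih => rw [add_comm, rhoI_comm]; exact ih.trans (.single h ht hs)

theorem LightlikeReach.exists_chain {x y : Mink n} {S : ℝ} (h : LightlikeReach Ω x y S) :
    ∃ c : LightlikeChain Ω x y, ∑ k, rhoI (c.s k) (c.t k) = S := by
  induction h with
  | @single γ s t h hs ht =>
    exact ⟨⟨0, fun _ => γ, fun _ => s, fun _ => t, fun _ => h, fun _ => hs, fun _ => ht, rfl, rfl,
      fun k => k.elim0⟩, by simp⟩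
  | @cons γ s t y S h hs ht _ ih =>
    obtain ⟨c, rfl⟩ := ih
    refine ⟨⟨c.m + 1, Fin.cons γ c.γ, Fin.cons s c.s, Fin.cons t c.t, ?_, ?_, ?_, rfl, ?_, ?_⟩, ?_⟩
    · exact Fin.cases h c.ppl
    · exact Fin.cases hs c.s_mem
    · exact Fin.cases ht c.t_mem
    · rw [← Fin.succ_last]; exact c.last
    · refine Fin.cases ?_ fun k => ?_
      · exact c.head.symm
      · exact c.link k
    · rw [Fin.sum_univ_succ]; rfl

theorem lightlikeReach_of_fin : ∀ (m : ℕ) (γ : Fin (m + 1) → ℝ → Mink n) (s t : Fin (m + 1) → ℝ),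
    (∀ k, IsPPL Ω (γ k)) → (∀ k, s k ∈ baseInterval) → (∀ k, t k ∈ baseInterval) →
    (∀ k : Fin m, γ k.castSucc (t k.castSucc) = γ k.succ (s k.succ)) →
    LightlikeReach Ω (γ 0 (s 0)) (γ (Fin.last m) (t (Fin.last m))) (∑ k, rhoI (s k) (t k))
  | 0, γ, s, t, h, hs, ht, _ => by simpa using LightlikeReach.single (h 0) (hs 0) (ht 0)
  | m + 1, γ, s, t, h, hs, ht, hl => by
    have ih := lightlikeReach_of_fin m (fun k => γ k.succ) (fun k => s k.succ)
      (fun k => t k.succ) (fun k => h _) (fun k => hs _) (fun k => ht _) fun k => by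
        simpa using hl k.succ
    rw [Fin.sum_univ_succ]
    refine .cons (h 0) (hs 0) (ht 0) ?_
    have := hl 0
    rw [Fin.castSucc_zero] at this
    rw [this]
    exact ih

theorem LightlikeChain.reach {x y : Mink n} (c : LightlikeChain Ω x y) :
    LightlikeReach Ω x y (∑ k, rhoI (c.s k) (c.t k)) := by
  have := lightlikeReach_of_fin c.m c.γ c.s c.t c.ppl c.s_mem c.t_mem c.link
  rwa [c.head, c.last] at this

theorem LightlikeReach.markowitzDist_le {x y : Mink n} {S : ℝ} (h : LightlikeReach Ω x y S) :
    markowitzDist Ω x y ≤ ENNReal.ofReal S := by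
  obtain ⟨c, rfl⟩ := h.exists_chain
  exact iInf_le _ c

theorem markowitzDist_comm (x y : Mink n) : markowitzDist Ω x y = markowitzDist Ω y x :=
  le_antisymm (le_iInf fun c => c.reach.symm.markowitzDist_le)
    (le_iInf fun c => c.reach.symm.markowitzDist_le)

theorem markowitzDist_triangle (x y z : Mink n) :
    markowitzDist Ω x z ≤ markowitzDist Ω x y + markowitzDist Ω y z := by
  unfold markowitzDist
  rw [ENNReal.iInf_add]
  refine le_iInf fun c => ?_
  rw [ENNReal.add_iInf]
  refine le_iInf fun c' => ?_
  exact (c.reach.trans c'.reach).markowitzDist_le.trans ENNReal.ofReal_add_le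

/-- The hypothesis serves the case `m = 0`: a lightlike chain has at least one member, so a
vanishing distance from a point to itself is not automatic. -/
theorem markowitzDist_fin_le : ∀ (m : ℕ) (p : Fin (m + 1) → Mink n),
    markowitzDist Ω (p 0) (p 0) = 0 →
    markowitzDist Ω (p 0) (p (Fin.last m)) ≤ ∑ k : Fin m, markowitzDist Ω (p k.castSucc) (p k.succ)
  | 0, p, h => by simp [h]
  | m + 1, p, h => by
    rw [Fin.sum_univ_castSucc]
    refine (markowitzDist_triangle _ (p (Fin.last m).castSucc) _).trans (add_le_add ?_ ?_)
    · exact markowitzDist_fin_le m (fun k => p k.castSucc) h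
    · rw [Fin.succ_last]

theorem abs_sub_fin_le : ∀ (m : ℕ) (f : Fin (m + 1) → ℝ),
    |f (Fin.last m) - f 0| ≤ ∑ k : Fin m, |f k.succ - f k.castSucc|
  | 0, f => by simp
  | m + 1, f => by
    refine le_of_le_of_eq ?_ ((add_comm _ _).trans (Fin.sum_univ_castSucc _).symm)
    refine (abs_sub_le _ (f (Fin.last m).castSucc) _).trans (add_le_add ?_ ?_)
    · rw [Fin.succ_last]
    · exact abs_sub_fin_le m (fun k => f k.castSucc)

theorem ofReal_abs_sub_le_nullDist (F : Mink n → ℝ) (x y : Mink n) :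
    ENNReal.ofReal |F y - F x| ≤ nullDist Ω F x y := by
  refine le_iInf fun c => ENNReal.ofReal_le_ofReal ?_
  have := abs_sub_fin_le c.m fun k => F (c.pt k)
  rwa [c.head, c.last] at this

theorem nullDist_le_of_related (F : Mink n → ℝ) {x y : Mink n} (hx : x ∈ Ω) (hy : y ∈ Ω)
    (h : CausalLE Ω x y) : nullDist Ω F x y ≤ ENNReal.ofReal |F y - F x| := by
  refine (iInf_le _ ⟨1, ![x, y], ?_, rfl, rfl, ?_⟩).trans ?_
  · simp
  · intro k; fin_cases k
    exacts [hx, hy]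
  · intro k; fin_cases k; exact Or.inl h

/-- The points of a projectively parametrized lightlike geodesic. -/
theorem IsPPL.exists_line {γ : ℝ → Mink n} (h : IsPPL Ω γ) {s t : ℝ} (hs : s ∈ baseInterval)
    (ht : t ∈ baseInterval) : ∃ (p v : Mink n) (a b : ℝ), IsLightlike v ∧ γ s = p + a • v ∧
      γ t = p + b • v ∧ γ s ∈ Ω ∧ γ t ∈ Ω ∧
      ∀ φ₀ φ₁ : ℝ, (∀ r : ℝ, p + r • v ∈ Ω → 0 < φ₀ + φ₁ * r) →
        |Real.log (φ₀ + φ₁ * b) - Real.log (φ₀ + φ₁ * a)| ≤ rhoI s t := by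
  obtain ⟨J, p, v, u, hJ, hJc, hv, hm, hu, hu', hS, hb, hγ⟩ := h
  obtain ⟨a, ha, rfl⟩ := hb.surjOn hs
  obtain ⟨b, hb', rfl⟩ := hb.surjOn ht
  refine ⟨p, v, a, b, hv, hγ a ha, hγ b hb', hγ a ha ▸ hm a ha, hγ b hb' ▸ hm b hb',
    fun φ₀ φ₁ hφ => ?_⟩
  exact abs_log_affine_le_rhoI hJ hJc hu hu' hS hb (fun t ht => hφ t (hm t ht)) ha hb'

/-- The nodes of a lightlike chain form a causal chain. The general `c` and `F` serve `ln τ` with `c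
= 1`, cones with `c = 2`, and logarithms of supporting functionals. -/
theorem nullDist_le_markowitzDist (hΩ : Convex ℝ Ω) {c : ℝ} (hc : 0 ≤ c) {F : Mink n → ℝ}
    (hF : ∀ γ, IsPPL Ω γ → ∀ s ∈ baseInterval, ∀ t ∈ baseInterval,
      c * |F (γ t) - F (γ s)| ≤ rhoI s t) (x y : Mink n) :
    ENNReal.ofReal c * nullDist Ω F x y ≤ markowitzDist Ω x y := by
  refine le_iInf fun d => ?_
  let pt : Fin (d.m + 2) → Mink n := Fin.cons x fun k => d.γ k (d.t k)
  have hpt : ∀ k : Fin (d.m + 1), pt k.castSucc = d.γ k (d.s k) := by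
    refine Fin.cases d.head.symm fun k => ?_
    rw [← d.link k]; rfl
  have hpt' : ∀ k : Fin (d.m + 1), pt k.succ = d.γ k (d.t k) := fun k => rfl
  have hmem : ∀ k, pt k ∈ Ω := by
    refine Fin.cases ?_ fun k => ?_
    · obtain ⟨_, _, _, _, _, _, _, h, -⟩ := (d.ppl 0).exists_line (d.s_mem 0) (d.t_mem 0)
      rw [d.head] at h
      exact h
    · obtain ⟨_, _, _, _, _, _, _, -, h, -⟩ := (d.ppl k).exists_line (d.s_mem k) (d.t_mem k)
      exact h
  have hrel : ∀ k : Fin (d.m + 1),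
      CausalLE Ω (pt k.castSucc) (pt k.succ) ∨ CausalLE Ω (pt k.succ) (pt k.castSucc) := by
    intro k
    obtain ⟨p, v, a, b, hv, ha, hb, -⟩ := (d.ppl k).exists_line (d.s_mem k) (d.t_mem k)
    have e : ∀ w : Mink n, InCone w → ∀ q : ℝ, pt k.succ - pt k.castSucc = q • w →
        CausalLE Ω (pt k.castSucc) (pt k.succ) ∨ CausalLE Ω (pt k.succ) (pt k.castSucc) := by
      intro w hw q hq
      rcases le_total 0 q with h0 | h0
      · exact Or.inl (causalLE_of_inCone hΩ (hmem _) (hmem _) (hq ▸ hw.smul h0))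
      · refine Or.inr (causalLE_of_inCone hΩ (hmem _) (hmem _) ?_)
        rw [← neg_sub, hq, ← neg_smul]
        exact hw.smul (by linarith)
    have hd : pt k.succ - pt k.castSucc = (b - a) • v := by
      rw [hpt, hpt', ha, hb]; module
    rcases hv.future_or_past with hv | hv
    · exact e v hv.inCone _ hd
    · exact e (-v) hv.inCone (a - b) (by rw [hd]; module)
  refine (mul_le_mul_right (iInf_le _ ⟨d.m + 1, pt, hmem, rfl, d.last, hrel⟩) _).trans ?_
  rw [← ENNReal.ofReal_mul hc]
  refine ENNReal.ofReal_le_ofReal ?_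
  rw [Finset.mul_sum]
  refine Finset.sum_le_sum fun k _ => ?_
  change c * |F (pt (Fin.succ k)) - F (pt (Fin.castSucc k))| ≤ _
  rw [hpt, hpt']
  exact hF _ (d.ppl k) _ (d.s_mem k) _ (d.t_mem k)

theorem IsRay.markowitzDist_le {z v : Mink n} (hz : IsRay Ω z v) {s t : ℝ} (hs : 0 < s)
    (ht : 0 < t) :
    markowitzDist Ω (z + s • v) (z + t • v) ≤ ENNReal.ofReal |Real.log (t / s)| := by
  have := LightlikeReach.single hz.isPPL (rayParam_mem hs) (rayParam_mem ht)
  simp only [rayParam_left_inv hs, rayParam_left_inv ht, rhoI_rayParam hs ht] at this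
  exact this.markowitzDist_le

/-! ### Comparison of the two distances -/

namespace IsRegular

theorem markowitzDist_self (h : IsRegular Ω) (hn : 1 ≤ n) {x : Mink n} (hx : x ∈ Ω) :
    markowitzDist Ω x x = 0 := by
  obtain ⟨v, hv, -⟩ := exists_future_neg_form_eq hn (0 : Mink n)
  obtain ⟨z, s, hs, hz, rfl⟩ := h.exists_ray hx hv
  simpa [hs.ne'] using hz.markowitzDist_le hs hs

/-- Each causal link splits into two lightlike steps. By `hF` the function `F` is monotone along
both, so the increments add up to that of the link without loss. -/
theorem markowitzDist_le_nullDist (h : IsRegular Ω) (hn : 1 ≤ n) {c : ℝ} (hc : 0 < c)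
    {F : Mink n → ℝ} (hF : ∀ z v, IsRay Ω z v → ∀ s t : ℝ, 0 < s → s ≤ t →
      Real.log (t / s) ≤ c * (F (z + t • v) - F (z + s • v))) (x y : Mink n) :
    markowitzDist Ω x y ≤ ENNReal.ofReal c * nullDist Ω F x y := by
  have step : ∀ x ∈ Ω, ∀ v, IsFutureLightlike v → ∀ a : ℝ, 0 ≤ a →
      0 ≤ c * (F (x + a • v) - F x) ∧
      markowitzDist Ω x (x + a • v) ≤ ENNReal.ofReal (c * (F (x + a • v) - F x)) := by
    intro x hx v hv a ha
    obtain ⟨z, s, hs, hz, rfl⟩ := h.exists_ray hx hv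
    rw [add_assoc, ← add_smul]
    have h1 := hF z v hz s (s + a) hs (by linarith)
    have h2 : 0 ≤ Real.log ((s + a) / s) := Real.log_nonneg (by rw [one_le_div hs]; linarith)
    refine ⟨h2.trans h1, (hz.markowitzDist_le hs (by linarith)).trans ?_⟩
    rw [abs_of_nonneg h2]
    exact ENNReal.ofReal_le_ofReal h1
  have step2 : ∀ x ∈ Ω, ∀ y, InCone (y - x) →
      markowitzDist Ω x y ≤ ENNReal.ofReal (c * |F y - F x|) := by
    intro x hx y hw
    obtain ⟨v₁, v₂, α, β, h1, h2, hα, hβ, he⟩ := hw.exists_lightlike hn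
    have hy : y = x + α • v₁ + β • v₂ := by rw [add_assoc, ← he]; abel
    obtain ⟨e1, e2⟩ := step x hx v₁ h1 α hα
    obtain ⟨e3, e4⟩ := step _ (h.add_mem x hx _ (h1.inCone.smul hα)) v₂ h2 β hβ
    rw [← hy] at e3 e4
    refine (markowitzDist_triangle _ _ _).trans ((add_le_add e2 e4).trans ?_)
    rw [← ENNReal.ofReal_add e1 e3]
    refine ENNReal.ofReal_le_ofReal ?_
    have := mul_le_mul_of_nonneg_left (le_abs_self (F y - F x)) hc.le
    linarith
  rw [nullDist, ENNReal.mul_iInf_of_ne (by simpa using hc) ENNReal.ofReal_ne_top]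
  refine le_iInf fun d => ?_
  rw [← ENNReal.ofReal_mul hc.le, Finset.mul_sum, ENNReal.ofReal_sum_of_nonneg
    fun k _ => mul_nonneg hc.le (abs_nonneg _)]
  have h1 := markowitzDist_fin_le (Ω := Ω) d.m d.pt (h.markowitzDist_self hn (d.mem 0))
  rw [d.head, d.last] at h1
  refine h1.trans (Finset.sum_le_sum fun k _ => ?_)
  rcases d.related k with hr | hr
  · exact step2 _ (d.mem _) _ hr.inCone
  · rw [markowitzDist_comm, abs_sub_comm]
    exact step2 _ (d.mem _) _ hr.inCone

theorem abs_log_tau_ray_le (h : IsRegular Ω) (hn : 1 ≤ n) {z v : Mink n} (hz : IsRay Ω z v)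
    {s t : ℝ} (hs : 0 < s) (ht : 0 < t) :
    |Real.log (tau Ω (z + t • v)) - Real.log (tau Ω (z + s • v))| ≤
      |Real.log t - Real.log s| := by
  wlog hst : s ≤ t generalizing s t
  · rw [abs_sub_comm, abs_sub_comm (Real.log t)]
    exact this ht hs (le_of_not_ge hst)
  have hs' := h.tau_pos hn (hz.mem s hs)
  have ht' := h.tau_pos hn (hz.mem t ht)
  have h1 : tau Ω (z + s • v) ≤ tau Ω (z + t • v) := by
    rcases hst.eq_or_lt with rfl | hlt
    · rfl
    · exact (h.tau_ray_lt hn hz hs hlt).le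
  have h2 := Real.log_le_log (mul_pos hs ht') (h.tau_ray_le hn hz hs hst)
  rw [Real.log_mul hs.ne' ht'.ne', Real.log_mul ht.ne' hs'.ne'] at h2
  rw [abs_of_nonneg (sub_nonneg.2 (Real.log_le_log hs' h1)),
    abs_of_nonneg (sub_nonneg.2 (Real.log_le_log hs hst))]
  linarith

theorem log_div_le_two_mul (h : IsRegular Ω) (hn : 1 ≤ n) {z v : Mink n} (hz : IsRay Ω z v)
    {s t : ℝ} (hs : 0 < s) (hst : s ≤ t) :
    Real.log (t / s) ≤ 2 * (logTime Ω (z + t • v) - logTime Ω (z + s • v)) := by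
  have ht := hs.trans_le hst
  have hs' := h.tau_pos hn (hz.mem s hs)
  have ht' := h.tau_pos hn (hz.mem t ht)
  have h2 := Real.log_le_log (mul_pos ht (pow_pos hs' 2)) (h.tau_sq_ray_le hn hz hs hst)
  rw [Real.log_mul ht.ne' (pow_pos hs' 2).ne', Real.log_mul hs.ne' (pow_pos ht' 2).ne',
    Real.log_pow, Real.log_pow] at h2
  rw [logTime_eq, logTime_eq, Real.log_div ht.ne' hs.ne']
  push_cast at h2
  linarith

/-- The geodesic runs inside a ray, whose parameter is a positive affine function on it; `ln τ`
varies no more than the logarithm of that parameter. -/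
theorem abs_logTime_le_rhoI (h : IsRegular Ω) (hn : 1 ≤ n) {γ : ℝ → Mink n} (hγ : IsPPL Ω γ)
    {s t : ℝ} (hs : s ∈ baseInterval) (ht : t ∈ baseInterval) :
    |logTime Ω (γ t) - logTime Ω (γ s)| ≤ rhoI s t := by
  obtain ⟨p, v, a, b, hv, ha, hb, hma, hmb, key⟩ := hγ.exists_line hs ht
  have main : ∀ (w : Mink n) (ε : ℝ), IsFutureLightlike w → v = ε • w →
      |logTime Ω (γ t) - logTime Ω (γ s)| ≤ rhoI s t := by
    intro w ε hw hε
    obtain ⟨z, q, hq, hz, he⟩ := h.exists_ray hma hw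
    have e : ∀ r : ℝ, p + r • v = z + ((q - ε * a) + ε * r) • w := fun r => by
      have : p = z + q • w - a • v := by rw [← he, ha]; abel
      rw [this, hε]; module
    have hpos : ∀ r : ℝ, p + r • v ∈ Ω → 0 < (q - ε * a) + ε * r := fun r hr =>
      hz.pos_of_mem h (e r ▸ hr)
    refine le_trans ?_ (key _ _ hpos)
    rw [logTime_eq, logTime_eq, ha, hb, e a, e b]
    exact h.abs_log_tau_ray_le hn hz (hpos a (ha ▸ hma)) (hpos b (hb ▸ hmb))
  rcases hv.future_or_past with hv | hv
  · exact main v 1 hv (by simp)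
  · exact main (-v) (-1) hv (by simp)

/-- The Markowitz distance along lightlike rays. -/
theorem le_markowitzDist_ray (h : IsRegular Ω) (hn : 1 ≤ n) {z v : Mink n} (hz : IsRay Ω z v)
    {s t : ℝ} (hs : 0 < s) (hst : s ≤ t) :
    ENNReal.ofReal (Real.log (t / s)) ≤ markowitzDist Ω (z + s • v) (z + t • v) := by
  have ht := hs.trans_le hst
  -- On this ray the supporting functional at `z` is a positive multiple of the parameter, so its
  -- logarithm has increment exactly `ln (t / s)`.
  obtain ⟨u, -, hu⟩ := h.exists_support hn hz.notMem
  have h1 := nullDist_le_markowitzDist h.convex zero_le_one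
    (F := fun x => Real.log (-form u (x - z))) (fun γ hγ s hs t ht => by
      obtain ⟨p, v, a, b, hv, ha, hb, hma, hmb, key⟩ := hγ.exists_line hs ht
      have e : ∀ r : ℝ, -form u (p + r • v - z) = -form u (p - z) + -form u v * r := fun r => by
        rw [show p + r • v - z = (p - z) + r • v by module, form_add_right, form_smul_right]; ring
      rw [one_mul, ha, hb, e, e]
      exact key _ _ fun r hr => e r ▸ hu _ hr) (z + s • v) (z + t • v)
  rw [ENNReal.ofReal_one, one_mul] at h1
  refine le_trans ?_ ((ofReal_abs_sub_le_nullDist _ _ _).trans h1)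
  refine ENNReal.ofReal_le_ofReal ((le_abs_self _).trans' (le_of_eq ?_))
  have h2 := hu _ (hz.mem s hs)
  simp only [add_sub_cancel_left, form_smul_right] at h2 ⊢
  have h3 : -form u v ≠ 0 := by intro h0; rw [neg_eq_zero.1 h0] at h2; simp at h2
  rw [← mul_neg, ← mul_neg, Real.log_mul ht.ne' h3, Real.log_mul hs.ne' h3,
    Real.log_div ht.ne' hs.ne']
  ring

/-- Between points of one ray both distances are explicit: `ln (t / s)` for Markowitz, the increment
of `ln τ` for the null distance. -/
theorem log_div_eq_of_markowitzDist_eq (h : IsRegular Ω) (hn : 1 ≤ n) {c : ℝ} (hc : 0 ≤ c)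
    (heq : ∀ x ∈ Ω, ∀ y ∈ Ω,
      markowitzDist Ω x y = ENNReal.ofReal c * nullDist Ω (logTime Ω) x y)
    {z v : Mink n} (hz : IsRay Ω z v) {s t : ℝ} (hs : 0 < s) (hst : s ≤ t) :
    Real.log (t / s) = c * (logTime Ω (z + t • v) - logTime Ω (z + s • v)) := by
  have ht := hs.trans_le hst
  have hms := hz.mem s hs
  have hmt := hz.mem t ht
  have hlog : 0 ≤ Real.log (t / s) := Real.log_nonneg (by rwa [one_le_div hs])
  have h1 : markowitzDist Ω (z + s • v) (z + t • v) = ENNReal.ofReal (Real.log (t / s)) :=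
    le_antisymm (by simpa [abs_of_nonneg hlog] using hz.markowitzDist_le hs ht)
      (h.le_markowitzDist_ray hn hz hs hst)
  have hcone : InCone (z + t • v - (z + s • v)) := by
    rw [show z + t • v - (z + s • v) = (t - s) • v by module]
    exact hz.lightlike.inCone.smul (sub_nonneg.2 hst)
  have h2 := le_antisymm
    (nullDist_le_of_related (logTime Ω) hms hmt (causalLE_of_inCone h.convex hms hmt hcone))
    (ofReal_abs_sub_le_nullDist (Ω := Ω) (logTime Ω) _ _)
  have hnn := sub_nonneg.2 (h.logTime_mono hn hms hcone)
  rw [abs_of_nonneg hnn] at h2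
  have h3 := heq _ hms _ hmt
  rw [h1, h2, ← ENNReal.ofReal_mul hc] at h3
  exact (ENNReal.ofReal_eq_ofReal_iff hlog (mul_nonneg hc hnn)).1 h3

theorem tau_ray_eq_of_markowitzDist_eq (h : IsRegular Ω) (hn : 1 ≤ n) {c : ℝ} (hc : 0 < c)
    (k : ℕ) (hk : (k : ℝ) = c) (heq : ∀ x ∈ Ω, ∀ y ∈ Ω,
      markowitzDist Ω x y = ENNReal.ofReal c * nullDist Ω (logTime Ω) x y)
    (z v : Mink n) (hz : IsRay Ω z v) (s t : ℝ) (hs : 0 < s) (ht : 0 < t) :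
    t * tau Ω (z + s • v) ^ k = s * tau Ω (z + t • v) ^ k := by
  wlog hst : s ≤ t generalizing s t
  · exact (this t s ht hs (le_of_not_ge hst)).symm
  have h1 := h.log_div_eq_of_markowitzDist_eq hn hc.le heq hz hs hst
  have hs' := h.tau_pos hn (hz.mem s hs)
  have ht' := h.tau_pos hn (hz.mem t ht)
  rw [logTime_eq, logTime_eq, Real.log_div ht.ne' hs.ne', ← hk] at h1
  refine Real.log_injOn_pos (mul_pos ht (pow_pos hs' k)) (mul_pos hs (pow_pos ht' k)) ?_
  rw [Real.log_mul ht.ne' (pow_pos hs' k).ne', Real.log_mul hs.ne' (pow_pos ht' k).ne',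
    Real.log_pow, Real.log_pow]
  linarith

end IsRegular

end Mink

namespace Mink

variable {n : ℕ} {Ω : Set (Mink n)}

/-! ### Spacelike hyperplanes -/

/-- The functional `-form u`. -/
noncomputable def coForm (u : Mink n) : Mink n →ₗ[ℝ] ℝ where
  toFun x := -form u x
  map_add' x y := by rw [form_add_right]; ring
  map_smul' c x := by rw [form_smul_right, RingHom.id_apply, smul_eq_mul]; ring

theorem coForm_apply (u x : Mink n) : coForm u x = -form u x := rfl

/-- Otherwise `w` or `-w` would be future causal, and its pairing with `u` could not vanish. -/
theorem IsFutureTimelike.form_pos_of_orthogonal {u w : Mink n} (hu : IsFutureTimelike u)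
    (h : form u w = 0) (hw : w ≠ 0) : 0 < form w w := by
  by_contra! hneg
  rw [form_self, sub_nonpos, sq_le_sq, abs_norm] at hneg
  rcases le_total 0 w.1 with h0 | h0
  · rw [abs_of_nonneg h0] at hneg
    have := hu.neg_form_pos hneg (isFutureCausal_iff.1 (InCone.isFutureCausal hneg hw)).2
    linarith
  · rw [abs_of_nonpos h0] at hneg
    have hc : InCone (-w) := by simpa [InCone] using hneg
    have := hu.neg_form_pos hc (isFutureCausal_iff.1 (hc.isFutureCausal (neg_ne_zero.2 hw))).2
    rw [← neg_one_smul ℝ w, form_smul_right, h] at this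
    simp at this

theorem finrank_ker_coForm {u : Mink n} (hu : form u u ≠ 0) :
    Module.finrank ℝ (LinearMap.ker (coForm u)) = n := by
  have h0 : coForm u ≠ 0 := fun h => hu (by
    have := LinearMap.congr_fun h u
    rw [coForm_apply] at this
    simpa using this)
  have h1 := Module.Dual.finrank_ker_add_one_of_ne_zero (f := coForm u) h0
  have h2 : Module.finrank ℝ (Mink n) = n + 1 := by simp [add_comm]
  omega

theorem chronFuture_eq_halfSpace {u : Mink n} (hu : IsFutureTimelike u) {c : ℝ}
    {H : Set (Mink n)} (hH : ∀ x, x ∈ H ↔ -form u x = c) :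
    chronFuture H = {x | c < -form u x} := by
  have huu : 0 < -form u u := by linarith [hu.1]
  ext y
  rw [mem_chronFuture, Set.mem_ofPred_eq]
  constructor
  · rintro ⟨x, hx, ht⟩
    have := hu.neg_form_pos ht.inCone ht.fst_pos
    rw [form_sub_right] at this
    linarith [(hH x).1 hx]
  · intro hy
    refine ⟨y - ((-form u y - c) / -form u u) • u, (hH _).2 ?_, ?_⟩
    · rw [form_sub_right, form_smul_right]
      have : (-form u y - c) / -form u u * form u u = -(-form u y - c) := by
        rw [div_neg, neg_mul, div_mul_cancel₀ _ hu.1.ne]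
      rw [this]; ring
    · rw [sub_sub_cancel]
      exact hu.smul (div_pos (by linarith) huu)

theorem exists_isSpacelikeHyperplane {u : Mink n} (hu : IsFutureTimelike u) (c : ℝ) :
    ∃ H : AffineSubspace ℝ (Mink n), IsSpacelikeHyperplane H ∧
      chronFuture (H : Set (Mink n)) = {x | c < -form u x} := by
  have huu : 0 < -form u u := by linarith [hu.1]
  have hp : -form u ((c / -form u u) • u) = c := by
    rw [form_smul_right, ← mul_neg, div_mul_cancel₀ _ huu.ne']
  refine ⟨AffineSubspace.mk' ((c / -form u u) • u) (LinearMap.ker (coForm u)),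
    ⟨⟨_, AffineSubspace.self_mem_mk' _ _⟩, ?_, fun w hw hw0 => ?_⟩,
    chronFuture_eq_halfSpace hu fun x => ?_⟩
  · rw [AffineSubspace.direction_mk']
    exact finrank_ker_coForm hu.1.ne
  · rw [AffineSubspace.direction_mk', LinearMap.mem_ker, coForm_apply, neg_eq_zero] at hw
    exact hu.form_pos_of_orthogonal hw hw0
  · rw [SetLike.mem_coe, AffineSubspace.mem_mk', LinearMap.mem_ker, vsub_eq_sub, map_sub,
      coForm_apply, coForm_apply, hp, sub_eq_zero]

theorem IsSpacelikeHyperplane.chronFuture_eq {H : AffineSubspace ℝ (Mink n)}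
    (hH : IsSpacelikeHyperplane H) : ∃ (u : Mink n) (c : ℝ), IsFutureTimelike u ∧
      form u u = -1 ∧ chronFuture (H : Set (Mink n)) = {x | c < -form u x} := by
  obtain ⟨⟨p, hp⟩, hdim, hpos⟩ := hH
  have hfin : Module.finrank ℝ (Mink n) = n + 1 := by simp [add_comm]
  have hlt : H.direction < ⊤ := by
    refine lt_top_iff_ne_top.2 fun h => ?_
    rw [h, finrank_top] at hdim
    exact absurd (hdim.symm.trans hfin) (by omega)
  obtain ⟨f, hf0, hf⟩ := Submodule.exists_le_ker_of_lt_top _ hlt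
  obtain ⟨u, hu⟩ := exists_form_eq (LinearMap.toContinuousLinearMap f)
  have hfu : f = coForm u := LinearMap.ext hu
  have hker : H.direction = LinearMap.ker (coForm u) := by
    rw [← hfu]
    refine Submodule.eq_of_le_of_finrank_eq hf ?_
    have := Module.Dual.finrank_ker_add_one_of_ne_zero (f := f) hf0
    exact hdim.trans (Nat.succ_injective (this.trans hfin)).symm
  have hmem : ∀ w, w ∈ H.direction ↔ form u w = 0 := fun w => by
    rw [hker, LinearMap.mem_ker, coForm_apply, neg_eq_zero]
  have hu0 : u ≠ 0 := by
    rintro rfl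
    exact hf0 (by rw [hfu]; ext <;> simp [coForm_apply, form])
  have hneg : form u u < 0 := by
    rcases lt_trichotomy (form u u) 0 with h | h | h
    · exact h
    · exact absurd (hpos u ((hmem u).2 h) hu0) (by rw [h]; exact lt_irrefl _)
    · exfalso
      -- For a spacelike conormal, the projection of `∂ₜ` to its orthogonal complement is a timelike
      -- vector tangent to the hyperplane.
      set d : Mink n := dt - (form u dt / form u u) • u with hd
      have hdm : form u d = 0 := by
        rw [hd, form_sub_right, form_smul_right, div_mul_cancel₀ _ h.ne', sub_self]
      have h1 : 0 ≤ form d d := by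
        rcases eq_or_ne d 0 with h0 | h0
        · simp [h0, form]
        · exact (hpos d ((hmem d).2 hdm) h0).le
      have h2 : form (dt : Mink n) dt = -1 := by rw [form_dt]; simp [dt]
      have h3 : form d d = form (dt : Mink n) dt - form u dt ^ 2 / form u u := by
        have h4 : form d u = 0 := by rw [form_comm, hdm]
        conv_lhs => enter [2]; rw [hd]
        rw [form_sub_right, form_smul_right, h4, hd, form_sub_left, form_smul_left]
        ring
      have : 0 ≤ form u dt ^ 2 / form u u := by positivity
      linarith
  have hor : IsFutureTimelike u ∨ IsFutureTimelike (-u) := by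
    rw [form_self, sub_neg, sq_lt_sq, abs_norm] at hneg
    rcases le_total 0 u.1 with h0 | h0
    · left; rw [isFutureTimelike_iff]; rwa [abs_of_nonneg h0] at hneg
    · right; rw [isFutureTimelike_iff]; rw [abs_of_nonpos h0] at hneg; simpa using hneg
  obtain ⟨w, hw, ε, hε, hwu⟩ : ∃ w : Mink n, IsFutureTimelike w ∧ ∃ ε : ℝ, ε ≠ 0 ∧ w = ε • u := by
    rcases hor with h | h
    · exact ⟨u, h, 1, one_ne_zero, by simp⟩
    · exact ⟨-u, h, -1, by simp, by simp⟩
  have hl := hw.len_pos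
  refine ⟨(len w)⁻¹ • w, -form ((len w)⁻¹ • w) p, hw.smul (inv_pos.2 hl), ?_,
    chronFuture_eq_halfSpace (hw.smul (inv_pos.2 hl)) fun x => ?_⟩
  · have := hw.inCone.len_sq
    rw [form_smul_left, form_smul_right, ← neg_eq_iff_eq_neg.2 this.symm.symm]
    field_simp
  · rw [SetLike.mem_coe, ← AffineSubspace.vsub_right_mem_direction_iff_mem hp, vsub_eq_sub, hmem,
      form_sub_right, hwu, smul_smul, form_smul_left, form_smul_left, neg_inj, sub_eq_zero,
      mul_right_inj' (mul_ne_zero (inv_ne_zero (hwu ▸ hl.ne')) hε)]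

/-! ### Half-spaces -/

/-- Continuous concave functions on open sets have supergradients. -/
theorem exists_affine_ge_of_concaveOn {E : Type*} [NormedAddCommGroup E] [NormedSpace ℝ E]
    {s : Set E} {f : E → ℝ} (hf : ConcaveOn ℝ s f) (hs : IsOpen s) (hc : ContinuousOn f s) {x : E}
    (hx : x ∈ s) : ∃ L : E →L[ℝ] ℝ, ∀ y ∈ s, f y ≤ f x + L (y - x) := by
  have ho : IsOpen {p : E × ℝ | p.1 ∈ s ∧ p.2 < f p.1} := by
    have h1 : ContinuousOn (fun p : E × ℝ => f p.1 - p.2) (Prod.fst ⁻¹' s) :=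
      (hc.comp continuous_fst.continuousOn fun p hp => hp).sub continuous_snd.continuousOn
    have h2 := h1.isOpen_inter_preimage (hs.preimage continuous_fst) (isOpen_Ioi (a := (0 : ℝ)))
    convert h2 using 1
    ext p
    simp
  obtain ⟨g, hg⟩ := geometric_hahn_banach_open_point (x := (x, f x)) hf.convex_strict_hypograph ho
    (by simp)
  have hg' : ∀ y t, g (y, t) = g (y, 0) + t * g (0, 1) := fun y t => by
    rw [← smul_eq_mul, ← map_smul, ← map_add]; simp
  have hκ : 0 < g (0, 1) := by
    have := hg (x, f x - 1) ⟨hx, by simp⟩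
    rw [hg' x, hg' x (f x)] at this
    linarith
  refine ⟨-(g (0, 1))⁻¹ • g.comp (ContinuousLinearMap.inl ℝ E ℝ), fun y hy => ?_⟩
  have h1 : g (y, 0) + f y * g (0, 1) ≤ g (x, 0) + f x * g (0, 1) := by
    refine le_of_forall_pos_lt_add fun ε hε => ?_
    have := hg (y, f y - ε / g (0, 1)) ⟨hy, by simp; positivity⟩
    rw [hg' y, hg' x (f x), sub_mul, div_mul_cancel₀ _ hκ.ne'] at this
    linarith
  have h2 : g (y - x, 0) = g (y, 0) - g (x, 0) := by rw [← map_sub]; simp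
  simp only [smul_apply, ContinuousLinearMap.comp_apply,
    ContinuousLinearMap.inl_apply, smul_eq_mul, h2]
  have h3 : f y - f x ≤ (g (x, 0) - g (y, 0)) / g (0, 1) := by
    rw [le_div_iff₀ hκ]; linarith
  rw [div_eq_mul_inv] at h3
  linarith

namespace IsRegular

/-- If the cosmological time is linear along lightlike rays, the domain is a half-space. -/
theorem eq_halfSpace (h : IsRegular Ω) (hn : 1 ≤ n)
    (hτ : ∀ z v, IsRay Ω z v → ∀ s t : ℝ, 0 < s → 0 < t →
      t * tau Ω (z + s • v) = s * tau Ω (z + t • v)) :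
    ∃ (u : Mink n) (c : ℝ), IsFutureTimelike u ∧ Ω = {x | c < -form u x} := by
  obtain ⟨x₀, hx₀⟩ := h.nonempty
  obtain ⟨L, hL⟩ := exists_affine_ge_of_concaveOn (h.concaveOn_tau hn) h.isOpen
    (h.continuousOn_tau hn) hx₀
  obtain ⟨u, hu⟩ := exists_form_eq L
  set c := -form u x₀ - tau Ω x₀ with hc
  have hle : ∀ y ∈ Ω, tau Ω y ≤ -form u y - c := fun y hy => by
    have := hL y hy
    rw [hu, form_sub_right] at this
    linarith
  -- On a ray `τ` is linear and lies below an affine function. Contact at one interior parameter,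
  -- compared with `s / 2` and `2 * s`, forces coincidence, and the majorant vanishes at `z`.
  have hray : ∀ z v, IsRay Ω z v → ∀ s : ℝ, 0 < s → tau Ω (z + s • v) = -form u (z + s • v) - c →
      -form u z - c = 0 ∧ -form u v = tau Ω (z + (1 : ℝ) • v) := by
    intro z v hz s hs he
    have e : ∀ t : ℝ, -form u (z + t • v) = -form u z + t * -form u v := fun t => by
      rw [form_add_right, form_smul_right]; ring
    have hκ : ∀ t : ℝ, 0 < t → tau Ω (z + t • v) = t * tau Ω (z + (1 : ℝ) • v) := fun t ht => by
      have := hτ z v hz 1 t one_pos ht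
      linarith
    rw [hκ s hs, e] at he
    have h1 := hle _ (hz.mem (s / 2) (by positivity))
    have h2 := hle _ (hz.mem (2 * s) (by positivity))
    rw [hκ _ (by positivity), e] at h1 h2
    have h3 : -form u z - c = 0 := by nlinarith
    refine ⟨h3, ?_⟩
    have h4 : s * (-form u v) = s * tau Ω (z + (1 : ℝ) • v) := by linarith
    exact mul_left_cancel₀ hs.ne' h4
  have heq : ∀ y ∈ Ω, tau Ω y = -form u y - c := fun y hy =>
    h.ray_induction hn (Q := fun y => tau Ω y = -form u y - c) (fun z v hz s t hs ht he => by
      obtain ⟨h1, h2⟩ := hray z v hz s hs he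
      have := hτ z v hz 1 t one_pos ht
      rw [form_add_right, form_smul_right]
      rw [← h2] at this
      linarith) hx₀ hy (by rw [hc]; ring)
  have hupos : ∀ v, IsFutureLightlike v → 0 < -form u v := fun v hv => by
    obtain ⟨z, s, hs, hz, -⟩ := h.exists_ray hx₀ hv
    rw [(hray z v hz s hs (heq _ (hz.mem s hs))).2]
    exact h.tau_pos hn (hz.mem 1 one_pos)
  refine ⟨u, c, isFutureTimelike_of_neg_form_pos hn hupos, Set.Subset.antisymm (fun y hy => ?_) ?_⟩
  · have := h.tau_pos hn hy
    rw [heq y hy] at this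
    exact sub_pos.1 this
  -- Rays of `Ω` begin exactly on the hyperplane `-form u = c`, so moving back along one leaves `Ω`
  -- only when leaving the half-space.
  have back : ∀ y v, IsFutureLightlike v → ∀ a : ℝ, 0 ≤ a → c < -form u y → y + a • v ∈ Ω →
      y ∈ Ω := by
    intro y v hv a ha hy hm
    obtain ⟨z, s, hs, hz, he⟩ := h.exists_ray hm hv
    have hy' : y = z + (s - a) • v := by
      rw [sub_smul, add_sub, ← he]; abel
    have h1 := (hray z v hz s hs (heq _ (hz.mem s hs))).1
    rw [hy', form_add_right, form_smul_right] at hy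
    have h2 : 0 < (s - a) * -form u v := by linarith
    rw [hy']
    exact hz.mem _ (pos_of_mul_pos_left h2 (hupos v hv).le)
  intro y hy
  have hy : c < -form u y := hy
  obtain ⟨w, w', hw, hw', e⟩ := exists_common_future y x₀
  have hm : y + w ∈ Ω := e ▸ h.add_mem _ hx₀ _ hw'
  obtain ⟨v₁, v₂, α, β, h1, h2, hα, hβ, rfl⟩ := hw.exists_lightlike hn
  refine back y v₁ h1 α hα hy (back _ v₂ h2 β hβ ?_ (by rwa [add_assoc]))
  rw [form_add_right, form_smul_right]
  have := mul_nonneg hα (hupos v₁ h1).le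
  linarith

/-- Reverse Cauchy–Schwarz against the unit normal gives the upper bound; descending along the
normal to height `ε` above the boundary gives the lower one. -/
theorem tau_halfSpace (h : IsRegular Ω) (hn : 1 ≤ n) {u : Mink n} {c : ℝ}
    (hu : IsFutureTimelike u) (huu : form u u = -1) (hΩ : Ω = {x | c < -form u x}) {x : Mink n}
    (hx : x ∈ Ω) : tau Ω x = -form u x - c := by
  have hlen : len u = 1 := by rw [len, huu]; simp
  have hx' : c < -form u x := by rw [hΩ] at hx; exact hx
  refine le_antisymm ?_ (le_of_forall_pos_sub_le fun ε hε => ?_)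
  · obtain ⟨r, hr, -, ht, he, -⟩ := h.exists_retract hn hx
    have h1 : c ≤ -form u r := by
      have hcl : IsClosed {r : Mink n | c ≤ -form u r} :=
        isClosed_le continuous_const (by unfold form; fun_prop)
      refine closure_minimal (fun y hy => ?_) hcl hr
      rw [hΩ] at hy
      exact le_of_lt (Set.mem_ofPred_eq ▸ hy)
    have h2 := hu.inCone.len_mul_len_le ht.inCone
    rw [hlen, one_mul, form_sub_right] at h2
    rw [he]; linarith
  · rcases le_or_gt (-form u x - c - ε) 0 with h0 | h0
    · exact h0.trans (h.tau_pos hn hx).le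
    · have e : x - (x - (-form u x - c - ε) • u) = (-form u x - c - ε) • u := by module
      have h1 : x - (-form u x - c - ε) • u ∈ Ω := by
        rw [hΩ, Set.mem_ofPred_eq, form_sub_right, form_smul_right, huu]; linarith
      have := h.len_le_tau hn hx (subset_closure h1) (by rw [e]; exact hu.inCone.smul h0.le)
      rwa [e, len_smul h0.le, hlen, mul_one] at this

theorem log_div_le_halfSpace (h : IsRegular Ω) (hn : 1 ≤ n) {u : Mink n} {c : ℝ}
    (hu : IsFutureTimelike u) (huu : form u u = -1) (hΩ : Ω = {x | c < -form u x}) {z v : Mink n}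
    (hz : IsRay Ω z v) {s t : ℝ} (hs : 0 < s) (hst : s ≤ t) :
    Real.log (t / s) ≤ logTime Ω (z + t • v) - logTime Ω (z + s • v) := by
  have ht := hs.trans_le hst
  have hs' := h.tau_pos hn (hz.mem s hs)
  have ht' := h.tau_pos hn (hz.mem t ht)
  rw [logTime_eq, logTime_eq, ← Real.log_div ht'.ne' hs'.ne']
  refine Real.log_le_log (by positivity) ?_
  rw [div_le_div_iff₀ hs hs']
  rw [h.tau_halfSpace hn hu huu hΩ (hz.mem s hs), h.tau_halfSpace hn hu huu hΩ (hz.mem t ht),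
    form_add_right, form_add_right, form_smul_right, form_smul_right]
  have hz0 : -form u z ≤ c := by
    have := hz.notMem
    rw [hΩ, Set.mem_ofPred_eq, not_lt] at this
    exact this
  nlinarith

/-! ### Cones -/

/-- If the squared cosmological time is linear along lightlike rays, the domain is a cone. -/
theorem eq_cone (h : IsRegular Ω) (hn : 1 ≤ n)
    (hτ : ∀ z v, IsRay Ω z v → ∀ s t : ℝ, 0 < s → 0 < t →
      t * tau Ω (z + s • v) ^ 2 = s * tau Ω (z + t • v) ^ 2) :
    ∃ a : Mink n, Ω = chronFuture {a} := by
  obtain ⟨x₀, hx₀⟩ := h.nonempty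
  obtain ⟨r, hr, -, ht₀, he₀, -⟩ := h.exists_retract hn hx₀
  have key : ∀ y ∈ Ω, IsFutureTimelike (y - r) ∧ -form (y - r) (y - r) = tau Ω y ^ 2 := by
    refine fun y hy => h.ray_induction hn
      (Q := fun y => IsFutureTimelike (y - r) ∧ -form (y - r) (y - r) = tau Ω y ^ 2) ?_ hx₀ hy
      ⟨ht₀, by rw [he₀, ht₀.inCone.len_sq]⟩
    rintro z v hz s t hs ht ⟨h1, h2⟩
    have e : ∀ t : ℝ, -form (z + t • v - r) (z + t • v - r) =
        -form (z - r) (z - r) + t * (-2 * form (z - r) v) := fun t => by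
      rw [show z + t • v - r = (z - r) + t • v by module]
      generalize z - r = w
      rw [form_add_left, form_add_right, form_add_right, form_smul_left, form_smul_left,
        form_smul_right, form_smul_right, form_comm v w, hz.lightlike.form_self]
      ring
    set κ := tau Ω (z + (1 : ℝ) • v) ^ 2 with hκ
    have hκpos : 0 < κ := pow_pos (h.tau_pos hn (hz.mem 1 one_pos)) 2
    have hlin : ∀ t : ℝ, 0 < t → tau Ω (z + t • v) ^ 2 = t * κ := fun t ht => by
      have := hτ z v hz 1 t one_pos ht
      linarith
    have hbound : ∀ t : ℝ, 0 < t → IsFutureTimelike (z + t • v - r) →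
        -form (z - r) (z - r) + t * (-2 * form (z - r) v) ≤ t * κ := fun t ht htl => by
      rw [← e, ← hlin t ht, ← htl.inCone.len_sq]
      exact pow_le_pow_left₀ (len_nonneg _) (h.len_le_tau hn (hz.mem t ht) hr htl.inCone) 2
    have ho : IsOpen {t : ℝ | IsFutureTimelike (z + t • v - r)} :=
      isOpen_isFutureTimelike.preimage (by fun_prop)
    obtain ⟨δ, hδ, hb⟩ := Metric.isOpen_iff.1 ho s h1
    -- Keeps `s ± η` positive and timelike related to `r`. There the affine squared length lies
    -- below `t * κ`, with equality at `s`, so the two agree identically.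
    set η := min (δ / 2) (s / 2) with hη
    have hη0 : 0 < η := lt_min (by linarith) (by linarith)
    have hηδ : η < δ := (min_le_left _ _).trans_lt (by linarith)
    have hηs : η < s := (min_le_right _ _).trans_lt (by linarith)
    have h3 := hbound (s + η) (by linarith) (hb (by
      rw [Metric.mem_ball, Real.dist_eq, abs_lt]; constructor <;> linarith))
    have h4 := hbound (s - η) (by linarith) (hb (by
      rw [Metric.mem_ball, Real.dist_eq, abs_lt]; constructor <;> linarith))
    rw [e, hlin s hs] at h2
    have h5 : -2 * form (z - r) v = κ := by nlinarith
    have h6 : -form (z - r) (z - r) = 0 := by rw [h5] at h2; linarith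
    have h7 : -form (z + t • v - r) (z + t • v - r) = t * κ := by rw [e, h5, h6, zero_add]
    refine ⟨⟨by linarith [mul_pos ht hκpos], ?_⟩, by rw [h7, hlin t ht]⟩
    rw [form_dt, neg_lt_zero]
    -- If the vector were past directed, pairing with `v` would give `form (z - r) v ≥ 0`, against
    -- `-2 * form (z - r) v = κ > 0`.
    by_contra! hneg
    have h8 : form (z + t • v - r) (z + t • v - r) < 0 := by linarith [mul_pos ht hκpos]
    rw [form_self, sub_neg, sq_lt_sq, abs_norm, abs_of_nonpos hneg] at h8
    have hc : InCone (-(z + t • v - r)) := by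
      show ‖(-(z + t • v - r)).2‖ ≤ (-(z + t • v - r)).1
      rw [Prod.snd_neg, norm_neg, Prod.fst_neg]; exact h8.le
    have h9 := hc.neg_form_nonneg hz.lightlike.inCone
    rw [show -(z + t • v - r) = (-1 : ℝ) • (z - r) + (-t) • v by module, form_add_left,
      form_smul_left, form_smul_left, hz.lightlike.form_self] at h9
    linarith
  refine ⟨r, Set.Subset.antisymm (fun y hy => ?_) fun y hy => ?_⟩
  · exact mem_chronFuture.2 ⟨r, rfl, (key y hy).1⟩
  · obtain ⟨_, rfl, ht⟩ := mem_chronFuture.1 hy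
    exact h.mem_of_closure hr ht

/-- Every competitor `r` lies in the causal future of `a`, so the reverse triangle inequality makes
the apex the farthest point. -/
theorem tau_cone (h : IsRegular Ω) (hn : 1 ≤ n) {a : Mink n} (hΩ : Ω = chronFuture {a})
    {x : Mink n} (hx : x ∈ Ω) : IsFutureTimelike (x - a) ∧ tau Ω x = len (x - a) := by
  have hmem : ∀ y, y ∈ Ω ↔ IsFutureTimelike (y - a) := fun y => by
    rw [hΩ, mem_chronFuture]; simp
  have hxa := (hmem x).1 hx
  have ha : a ∈ closure Ω := by
    have hcont : Filter.Tendsto (fun ε : ℝ => a + ε • (dt : Mink n)) (nhdsWithin 0 (Set.Ioi 0))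
        (nhds a) := by
      have : Continuous fun ε : ℝ => a + ε • (dt : Mink n) := by fun_prop
      simpa using (this.tendsto 0).mono_left nhdsWithin_le_nhds
    refine mem_closure_of_tendsto hcont (Filter.mem_of_superset self_mem_nhdsWithin fun s hs => ?_)
    exact (hmem _).2 (by simpa using isFutureTimelike_dt.smul hs)
  refine ⟨hxa, le_antisymm ?_ (h.len_le_tau hn hx ha hxa.inCone)⟩
  obtain ⟨r, hr, -, ht, he, -⟩ := h.exists_retract hn hx
  have hra : InCone (r - a) := by
    have hcl : IsClosed {r : Mink n | InCone (r - a)} := isClosed_inCone.preimage (by fun_prop)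
    exact closure_minimal (fun y hy => ((hmem y).1 hy).inCone) hcl hr
  have := ht.inCone.len_add_len_le hra
  rw [sub_add_sub_cancel] at this
  rw [he]
  linarith [len_nonneg (r - a)]

/-- On a cone `τ²` is the squared length from `a`, which is affine along null lines; hence `2 ln τ`
is the logarithm of a positive affine function there. -/
theorem two_mul_abs_logTime_le_cone (h : IsRegular Ω) (hn : 1 ≤ n) {a : Mink n}
    (hΩ : Ω = chronFuture {a}) {γ : ℝ → Mink n} (hγ : IsPPL Ω γ) {s t : ℝ}
    (hs : s ∈ baseInterval) (ht : t ∈ baseInterval) :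
    2 * |logTime Ω (γ t) - logTime Ω (γ s)| ≤ rhoI s t := by
  obtain ⟨p, v, b, d, hv, hb, hd, hmb, hmd, key⟩ := hγ.exists_line hs ht
  have e : ∀ r : ℝ, -form (p + r • v - a) (p + r • v - a) =
      -form (p - a) (p - a) + (-2 * form (p - a) v) * r := fun r => by
    rw [show p + r • v - a = (p - a) + r • v by module]
    generalize p - a = w
    rw [form_add_left, form_add_right, form_add_right, form_smul_left, form_smul_left,
      form_smul_right, form_smul_right, form_comm v w, hv.2]
    ring
  have hlog : ∀ x ∈ Ω, 2 * logTime Ω x = Real.log (-form (x - a) (x - a)) := fun x hx => by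
    obtain ⟨h1, h2⟩ := h.tau_cone hn hΩ hx
    rw [← h1.inCone.len_sq, ← h2, Real.log_pow, logTime_eq]; norm_num
  have := key _ _ fun r hr => by
    rw [← e]; linarith [(h.tau_cone hn hΩ hr).1.1]
  rw [← e, ← e, ← hd, ← hb, ← hlog _ hmb, ← hlog _ hmd, ← mul_sub, abs_mul, abs_two] at this
  exact this

end IsRegular

/-! ### Finiteness and the main theorem -/

theorem nullDist_lt_top (h : IsRegular Ω) (F : Mink n → ℝ) {x y : Mink n} (hx : x ∈ Ω)
    (hy : y ∈ Ω) : nullDist Ω F x y < ⊤ := by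
  obtain ⟨w, w', hw, hw', e⟩ := exists_common_future x y
  have h1 := h.add_mem x hx w hw
  refine (iInf_le _ (⟨2, ![x, x + w, y], ?_, rfl, rfl, ?_⟩ : CausalChain Ω x y)).trans_lt
    ENNReal.ofReal_lt_top
  · intro k; fin_cases k
    exacts [hx, h1, hy]
  · intro k; fin_cases k
    · exact Or.inl (causalLE_of_inCone h.convex hx h1 (by simpa using hw))
    · exact Or.inr (causalLE_of_inCone h.convex hy h1 (by rw [e]; simpa using hw'))

end Mink

theorem mainTheorem7 (n : ℕ) (hn : 1 ≤ n) (Ω : Set (Mink n))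
    (hdom : Mink.IsSpacetimeDomain Ω) (hconv : Convex ℝ Ω)
    (hfut : Mink.IsFutureComplete Ω) (hline : ¬ Mink.ContainsLightlikeLine Ω) :
    ((∀ x ∈ Ω, 0 < Mink.cosmologicalTime Ω x ∧ Mink.cosmologicalTime Ω x < ⊤) ∧
      Mink.IsTimeFunction Ω (Mink.logTime Ω) ∧
      ∀ x ∈ Ω, ∀ y ∈ Ω, Mink.markowitzDist Ω x y < ⊤) ∧
    (∀ x ∈ Ω, ∀ y ∈ Ω,
      Mink.nullDist Ω (Mink.logTime Ω) x y ≤ Mink.markowitzDist Ω x y ∧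
      Mink.markowitzDist Ω x y ≤ 2 * Mink.nullDist Ω (Mink.logTime Ω) x y) ∧
    ((∀ x ∈ Ω, ∀ y ∈ Ω,
        Mink.nullDist Ω (Mink.logTime Ω) x y = Mink.markowitzDist Ω x y) ↔
      ∃ H : AffineSubspace ℝ (Mink n), Mink.IsSpacelikeHyperplane H ∧
        Ω = Mink.chronFuture (H : Set (Mink n))) ∧
    ((∀ x ∈ Ω, ∀ y ∈ Ω,
        Mink.markowitzDist Ω x y = 2 * Mink.nullDist Ω (Mink.logTime Ω) x y) ↔
      ∃ a : Mink n, Ω = Mink.chronFuture {a}) := by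
  have h := Mink.isRegular_of hdom hconv hfut hline
  have hle : ∀ x y, Mink.nullDist Ω (Mink.logTime Ω) x y ≤ Mink.markowitzDist Ω x y :=
    fun x y => by
      simpa using Mink.nullDist_le_markowitzDist hconv zero_le_one (F := Mink.logTime Ω)
        (fun γ hγ s hs t ht => by rw [one_mul]; exact h.abs_logTime_le_rhoI hn hγ hs ht) x y
  have hle2 : ∀ x y, Mink.markowitzDist Ω x y ≤ 2 * Mink.nullDist Ω (Mink.logTime Ω) x y :=
    fun x y => by
      simpa using h.markowitzDist_le_nullDist hn two_pos
        (fun z v hz s t hs hst => h.log_div_le_two_mul hn hz hs hst) x y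
  refine ⟨⟨fun x hx => h.cosmologicalTime_pos_lt_top hn hx, h.isTimeFunction hn,
    fun x hx y hy => (hle2 x y).trans_lt
      (ENNReal.mul_lt_top (by simp) (Mink.nullDist_lt_top h _ hx hy))⟩,
    fun x _ y _ => ⟨hle x y, hle2 x y⟩, ⟨fun heq => ?_, ?_⟩, ⟨fun heq => ?_, ?_⟩⟩
  · have hτ := h.tau_ray_eq_of_markowitzDist_eq hn one_pos 1 (by simp)
      fun x hx y hy => by simp [heq x hx y hy]
    simp only [pow_one] at hτ
    obtain ⟨u, c, hu, hΩ⟩ := h.eq_halfSpace hn hτ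
    obtain ⟨H, hH, hHΩ⟩ := Mink.exists_isSpacelikeHyperplane hu c
    exact ⟨H, hH, hΩ.trans hHΩ.symm⟩
  · rintro ⟨H, hH, hΩ⟩ x - y -
    obtain ⟨u, c, hu, huu, hHΩ⟩ := hH.chronFuture_eq
    refine le_antisymm (hle x y) ?_
    simpa using h.markowitzDist_le_nullDist hn one_pos (F := Mink.logTime Ω)
      (fun z v hz s t hs hst => by
        rw [one_mul]; exact h.log_div_le_halfSpace hn hu huu (hΩ.trans hHΩ) hz hs hst) x y
  · exact h.eq_cone hn (h.tau_ray_eq_of_markowitzDist_eq hn two_pos 2 (by simp)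
      fun x hx y hy => by simp [heq x hx y hy])
  · rintro ⟨a, hΩ⟩ x - y -
    refine le_antisymm (hle2 x y) ?_
    simpa using Mink.nullDist_le_markowitzDist hconv zero_le_two (F := Mink.logTime Ω)
      (fun γ hγ s hs t ht => h.two_mul_abs_logTime_le_cone hn hΩ hγ hs ht) x y
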